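/- There is a deterministic word-RAM algorithm that lists all 4-cycles of an undirected graph in time $\tilde O(m^{4/3}+t)$. Precisely: there are one program and constants $K, c, C$ such that the following holds for every finite simple undirected graph $G$ on the vertex set $\{0,\dots,n-1\}$ with $m$ edges and $t$ 4-cycles (counted as subgraphs), and for every word length $w$ with $2^w \ge K(n+m+1)$. Given $n$, $m$ and a list of the edges of $G$ (each edge once, in arbitrary order and orientation) in the otherwise zero-initialized memory of a unit-cost word RAM with $w$-bit words, the program halts after at most $$C\,\bigl(m^{4/3}+t+1\bigr)\,(\log (m+2))^{c}$$ steps, and its output is a sequence of 4-tuples $(v_1,v_2,v_3,v_4)$ of pairwise distinct vertices with $v_1v_2,\ v_2v_3,\ v_3v_4,\ v_4v_1\in E(G)$ in which every 4-cycle of $G$ is represented exactly once. -/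

import Mathlib

/-! A word RAM with `w`-bit words, programmed by structured (goto-free) programs. -/

namespace WordRAM

/-- Machine state: registers, random access memory, and a write-only output tape. -/
structure State where
  reg : ℕ → ℕ
  mem : ℕ → ℕ
  out : List ℕ

/-- Binary word operations. -/
inductive BinOp where
  | add | sub | mul | div | mod | and | or | xor | shl | shr

/-- The result of an operation on `w`-bit words, reduced modulo `2 ^ w`
(subtraction wraps around; division by zero gives `0`). -/
def BinOp.eval (w : ℕ) : BinOp → ℕ → ℕ → ℕ
  | .add, x, y => (x + y) % 2 ^ w
  | .sub, x, y => (x + (2 ^ w - y % 2 ^ w)) % 2 ^ w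
  | .mul, x, y => (x * y) % 2 ^ w
  | .div, x, y => (x / y) % 2 ^ w
  | .mod, x, y => (x % y) % 2 ^ w
  | .and, x, y => (x &&& y) % 2 ^ w
  | .or, x, y => (x ||| y) % 2 ^ w
  | .xor, x, y => (x ^^^ y) % 2 ^ w
  | .shl, x, y => (x <<< y) % 2 ^ w
  | .shr, x, y => (x >>> y) % 2 ^ w

/-- Elementary instructions; all arguments are register numbers, except the literal `k`. -/
inductive Instr where
  /-- register `d` becomes the literal `k` -/
  | const (d k : ℕ)
  /-- register `d` becomes the content of register `a` -/
  | move (d a : ℕ)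
  /-- register `d` becomes the result of `o` on registers `a` and `b` -/
  | op (o : BinOp) (d a b : ℕ)
  /-- register `d` becomes the memory cell whose address is in register `a` -/
  | load (d a : ℕ)
  /-- the memory cell whose address is in register `a` becomes the content of register `b` -/
  | store (a b : ℕ)
  /-- the content of register `a` is appended to the output -/
  | emit (a : ℕ)

/-- The effect of an elementary instruction on a machine with `w`-bit words. -/
def Instr.exec (w : ℕ) : Instr → State → State
  | .const d k, s => { s with reg := Function.update s.reg d (k % 2 ^ w) }
  | .move d a, s => { s with reg := Function.update s.reg d (s.reg a) }
  | .op o d a b, s => { s with reg := Function.update s.reg d (o.eval w (s.reg a) (s.reg b)) }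
  | .load d a, s => { s with reg := Function.update s.reg d (s.mem (s.reg a)) }
  | .store a b, s => { s with mem := Function.update s.mem (s.reg a) (s.reg b) }
  | .emit a, s => { s with out := s.out ++ [s.reg a] }

/-- Tests comparing the contents of two registers. -/
inductive Test where
  | eq (a b : ℕ)
  | ne (a b : ℕ)
  | lt (a b : ℕ)

/-- The test succeeds in the given state. -/
def Test.Holds : Test → State → Prop
  | .eq a b, s => s.reg a = s.reg b
  | .ne a b, s => s.reg a ≠ s.reg b
  | .lt a b, s => s.reg a < s.reg b

/-- Programs. -/
inductive Program where
  | skip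
  | instr (i : Instr)
  | seq (p q : Program)
  | cond (b : Test) (p q : Program)
  | loop (b : Test) (p : Program)

/-- `Runs w p s s' T`: on a machine with `w`-bit words, the program `p` started in state `s`
halts in state `s'` after exactly `T` steps. Every elementary instruction and every evaluation
of a test is one step. -/
inductive Runs (w : ℕ) : Program → State → State → ℕ → Prop where
  | skip (s : State) : Runs w .skip s s 1
  | instr (i : Instr) (s : State) : Runs w (.instr i) s (i.exec w s) 1
  | seq {p q : Program} {s s₁ s₂ : State} {T₁ T₂ : ℕ} :
      Runs w p s s₁ T₁ → Runs w q s₁ s₂ T₂ → Runs w (.seq p q) s s₂ (T₁ + T₂)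
  | cond_true {b : Test} {p q : Program} {s s₁ : State} {T : ℕ} :
      b.Holds s → Runs w p s s₁ T → Runs w (.cond b p q) s s₁ (1 + T)
  | cond_false {b : Test} {p q : Program} {s s₁ : State} {T : ℕ} :
      ¬ b.Holds s → Runs w q s s₁ T → Runs w (.cond b p q) s s₁ (1 + T)
  | loop_false {b : Test} {p : Program} {s : State} :
      ¬ b.Holds s → Runs w (.loop b p) s s 1
  | loop_true {b : Test} {p : Program} {s s₁ s₂ : State} {T₁ T₂ : ℕ} :
      b.Holds s → Runs w p s s₁ T₁ → Runs w (.loop b p) s₁ s₂ T₂ →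
      Runs w (.loop b p) s s₂ (1 + T₁ + T₂)

/-- The initial state for a list of pairs of vertices in `{0, …, n - 1}`: register `0` holds `n`,
register `1` holds the number of pairs, and the pairs occupy the memory from address `0` on, two
cells for each. All other registers and memory cells are `0`, and the output is empty. -/
def initState (n : ℕ) (L : List (Fin n × Fin n)) : State where
  reg := fun i => if i = 0 then n else if i = 1 then L.length else 0
  mem := fun i => (L.flatMap fun e => [(e.1 : ℕ), (e.2 : ℕ)]).getD i 0
  out := []

end WordRAM

/-- `L` lists every edge of the undirected graph `G` exactly once, in some order and with some
orientation, and nothing else. -/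
def IsEdgeList {V : Type*} (G : SimpleGraph V) (L : List (V × V)) : Prop :=
  (L.map fun e => s(e.1, e.2)).Nodup ∧ ∀ e : Sym2 V, e ∈ (L.map fun e => s(e.1, e.2)) ↔ e ∈ G.edgeSet

/-- The tuple `(a, b, c, d)` runs around a 4-cycle of `G`. -/
def IsFourCycle {V : Type*} (G : SimpleGraph V) (x : V × V × V × V) : Prop :=
  match x with
  | (a, b, c, d) => G.Adj a b ∧ G.Adj b c ∧ G.Adj c d ∧ G.Adj d a ∧ [a, b, c, d].Nodup

/-- The set of edges of the closed walk `a, b, c, d, a`. -/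
def cycleEdges {V : Type*} (x : V × V × V × V) : Set (Sym2 V) :=
  match x with
  | (a, b, c, d) => {s(a, b), s(b, c), s(c, d), s(d, a)}

/-- The 4-cycles of `G`, as subgraphs: each is given by its set of edges, so that the eight tuples
that run around the same cycle count once. -/
def fourCycles {V : Type*} (G : SimpleGraph V) : Set (Set (Sym2 V)) :=
  {S | ∃ x : V × V × V × V, IsFourCycle G x ∧ S = cycleEdges x}

/-- The word sequence `out` is a list of all 4-cycles of `G`: it is the concatenation of
4-tuples, each tuple runs around a 4-cycle of `G`, and every 4-cycle of `G` is represented by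
exactly one tuple. -/
def ListsFourCycles {n : ℕ} (G : SimpleGraph (Fin n)) (out : List ℕ) : Prop :=
  ∃ cyc : List (Fin n × Fin n × Fin n × Fin n),
    out = cyc.flatMap (fun x => [(x.1 : ℕ), (x.2.1 : ℕ), (x.2.2.1 : ℕ), (x.2.2.2 : ℕ)]) ∧
    (∀ x ∈ cyc, IsFourCycle G x) ∧
    (cyc.map cycleEdges).Nodup ∧
    ∀ S ∈ fourCycles G, S ∈ cyc.map cycleEdges

/-!
The algorithm is that of Chiba and Nishizeki. The vertices are ordered by degree. For each vertex
`v`, all paths `v, a, u` ("wedges") with `a` and `u` before `v` are enumerated and sorted by their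
endpoint `u`; any two wedges with the same endpoints `v` and `u` form a 4-cycle, and every 4-cycle
arises exactly once in this way, from its greatest vertex `v` and the two wedges from there to the
opposite vertex. Enumerating the wedges takes time `∑ deg a` over the edges `a v` with `a` before
`v`, hence at most `∑ min (deg a) (deg b)` over all edges `a b`, and the remaining work is
proportional to the size of the input and the output.

The point is that this sum is `O((m ^ (4 / 3) + t) log m)` (`sum_min_degree_le`). It suffices to
bound `θ e` for each power `θ` of `2`, where `e` is the number of edges spanned by the set `S` of
the vertices of degree at least `θ` (`mul_innerDarts_degree_ge_le`). This set has at most `2 m / θ`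
elements. If `θ ≤ m ^ (1 / 3)`, then `θ e ≤ θ m ≤ m ^ (4 / 3)`. Otherwise the Cauchy–Schwarz
inequality, applied twice, shows that `e` is `O(|S| ^ (3 / 2))`, or else `t` is at least of the
order of `e ^ 4 / |S| ^ 4` (`innerDarts_sq_le_or_pow_four_le`). In the first case `θ e` is
`O(m ^ (3 / 2) / θ ^ (1 / 2))`, which is `O(m ^ (4 / 3))`; in the second case `t` is at least of the
order of `(θ e) ^ 4 / m ^ 4`, which is at least `θ e` unless `θ e ≤ m ^ (4 / 3)`.

On the word RAM, the half-edges that start in a vertex are kept in a linked list, and so are the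
wedges that end in a vertex; the latter lists are emptied lazily when a new `v` is taken up, by
means of stamps, and only vertices that have an edge are visited, so that no step depends on the
number of vertices. A running time is tracked together with the amount of output it produces
(`WordRAM.Reaches`), so that the innermost loop, which writes a 4-cycle in each round, is free of
charge.
-/

/-! ### Counting 4-cycles in a graph with many edges -/

section Counting

open Finset
open scoped Classical in
/-- The tuples running around a 4-cycle: there are eight of them for every 4-cycle. -/
noncomputable def fourCycleTuples {V : Type*} [Fintype V] (G : SimpleGraph V) :
    Finset (V × V × V × V) :=
  univ.filter (IsFourCycle G)

theorem fourCycles_finite {V : Type*} [Finite V] (G : SimpleGraph V) : (fourCycles G).Finite :=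
  Set.toFinite _

theorem eq_or_of_mem_cycleEdges {V : Type*} {a b c d y z : V}
    (h : s(y, z) ∈ cycleEdges (a, b, c, d)) :
    y = a ∨ y = b ∨ y = c ∨ y = d := by
  simp only [cycleEdges, Set.mem_insert_iff, Set.mem_singleton_iff, Sym2.eq_iff] at h
  tauto

/-- The edge set of a 4-cycle determines its four vertices, and so the tuple up to
`4 ^ 4` possibilities. -/
theorem card_fourCycleTuples_le {V : Type*} [Fintype V] (G : SimpleGraph V) :
    #(fourCycleTuples G) ≤ 256 * (fourCycles G).ncard := by
  classical
  have hfin := fourCycles_finite G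
  rw [Set.ncard_eq_toFinset_card _ hfin]
  refine card_le_mul_card_image_of_maps_to (f := cycleEdges) ?_ 256 ?_
  · intro x hx
    simp only [fourCycleTuples, mem_filter, mem_univ, true_and] at hx
    simpa using ⟨x, hx, rfl⟩
  · intro S hS
    obtain ⟨⟨a, b, c, d⟩, -, rfl⟩ : S ∈ fourCycles G := by simpa using hS
    have hsub : (fourCycleTuples G).filter (fun x => cycleEdges x = cycleEdges (a, b, c, d)) ⊆
        ({a, b, c, d} : Finset V) ×ˢ ({a, b, c, d} : Finset V) ×ˢ
          ({a, b, c, d} : Finset V) ×ˢ ({a, b, c, d} : Finset V) := by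
      rintro ⟨a', b', c', d'⟩ hx
      have hS := (mem_filter.1 hx).2
      have key : ∀ y z, s(y, z) ∈ cycleEdges (a', b', c', d') →
          y ∈ ({a, b, c, d} : Finset V) := by
        intro y z h
        rw [hS] at h
        simpa only [mem_insert, mem_singleton] using eq_or_of_mem_cycleEdges h
      simp only [mem_product]
      refine ⟨key a' b' ?_, key b' c' ?_, key c' d' ?_, key d' a' ?_⟩ <;> simp [cycleEdges]
    have h4 : #({a, b, c, d} : Finset V) ≤ 4 := card_le_four
    calc _ ≤ _ := card_le_card hsub
      _ = #({a, b, c, d} : Finset V) * (#({a, b, c, d} : Finset V) *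
          (#({a, b, c, d} : Finset V) * #({a, b, c, d} : Finset V))) := by
        simp only [card_product]
      _ ≤ 4 * (4 * (4 * 4)) := by gcongr
      _ = 256 := by norm_num

variable {V : Type*} (G : SimpleGraph V) [DecidableRel G.Adj]

/-- The number of ordered pairs of adjacent vertices in `S`. -/
def innerDarts (S : Finset V) : ℕ := ∑ v ∈ S, #{u ∈ S | G.Adj u v}

/-- The number of walks of length two inside `S`. -/
def innerWedges (S : Finset V) : ℕ := ∑ v ∈ S, #{u ∈ S | G.Adj u v} ^ 2

theorem innerDarts_sq_le (S : Finset V) : innerDarts G S ^ 2 ≤ #S * innerWedges G S :=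
  sq_sum_le_card_mul_sum_sq

theorem innerWedges_eq_sum_codegree (S : Finset V) :
    innerWedges G S = ∑ p ∈ S ×ˢ S, #{v ∈ S | G.Adj p.1 v ∧ G.Adj v p.2} := by
  simp only [innerWedges, card_filter, sq, sum_mul_sum]
  rw [sum_product, sum_comm]
  refine sum_congr rfl fun u _ => ?_
  rw [sum_comm]
  refine sum_congr rfl fun w _ => sum_congr rfl fun v _ => ?_
  by_cases h1 : G.Adj u v <;> by_cases h2 : G.Adj w v <;> simp [h1, h2, G.adj_comm v w]

variable [Fintype V]

/-- A closed walk of length four is a 4-cycle, or it revisits its first vertex or its second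
one half-way; the walks of either degenerate kind are counted by walks of length two. -/
theorem sum_codegree_sq_le (S : Finset V) :
    ∑ p ∈ S ×ˢ S, #{v ∈ S | G.Adj p.1 v ∧ G.Adj v p.2} ^ 2 ≤
      #(fourCycleTuples G) + 2 * innerWedges G S := by
  classical
  let X : Finset (V × V × V × V) := {x ∈ S ×ˢ S ×ˢ S ×ˢ S |
    G.Adj x.1 x.2.1 ∧ G.Adj x.2.1 x.2.2.1 ∧ G.Adj x.2.2.1 x.2.2.2 ∧ G.Adj x.2.2.2 x.1}
  have hX : ∑ p ∈ S ×ˢ S, #{v ∈ S | G.Adj p.1 v ∧ G.Adj v p.2} ^ 2 = #X := by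
    simp only [X, card_filter, sq, sum_mul_sum, sum_product]
    refine sum_congr rfl fun u _ => ?_
    rw [sum_comm]
    refine sum_congr rfl fun v _ => ?_
    refine sum_congr rfl fun w _ => ?_
    refine sum_congr rfl fun v' _ => ?_
    by_cases h1 : G.Adj u v <;> by_cases h2 : G.Adj v w <;> by_cases h3 : G.Adj w v' <;>
      by_cases h4 : G.Adj v' u <;> simp [h1, h2, h3, h4, G.adj_comm u v', G.adj_comm v' w]
  let T : Finset (V × V × V) := {x ∈ S ×ˢ S ×ˢ S | G.Adj x.1 x.2.1 ∧ G.Adj x.2.1 x.2.2}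
  have hT : #T = innerWedges G S := by
    rw [innerWedges_eq_sum_codegree]
    simp only [T, card_filter, sum_product]
    refine sum_congr rfl fun u _ => ?_
    rw [sum_comm]
  have hsub : X ⊆ fourCycleTuples G ∪
      (T.image (fun x => (x.1, x.2.1, x.2.2, x.2.1)) ∪
        T.image (fun x => (x.2.1, x.1, x.2.1, x.2.2))) := by
    rintro ⟨a, b, c, d⟩ hx
    simp only [X, mem_filter, mem_product] at hx
    obtain ⟨⟨ha, hb, hc, hd⟩, hab, hbc, hcd, hda⟩ := hx
    simp only [mem_union, mem_image, T, mem_filter, mem_product, Prod.exists, Prod.mk.injEq]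
    by_cases hbd : b = d
    · subst hbd
      exact Or.inr (Or.inl ⟨a, b, c, ⟨⟨ha, hb, hc⟩, hab, hbc⟩, rfl, rfl, rfl, rfl⟩)
    by_cases hac : a = c
    · subst hac
      exact Or.inr (Or.inr ⟨b, a, d, ⟨⟨hb, ha, hd⟩, hbc, hcd⟩, rfl, rfl, rfl, rfl⟩)
    · refine Or.inl ?_
      simp only [fourCycleTuples, mem_filter, mem_univ, true_and, IsFourCycle]
      refine ⟨hab, hbc, hcd, hda, ?_⟩
      simp [hab.ne, hbc.ne, hcd.ne, hda.ne.symm, hac, hbd]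
  rw [hX]
  calc #X ≤ _ := card_le_card hsub
    _ ≤ _ := card_union_le _ _
    _ ≤ _ := by
      have h1 : #(T.image (fun x => (x.1, x.2.1, x.2.2, x.2.1))) ≤ #T := card_image_le
      have h2 : #(T.image (fun x => (x.2.1, x.1, x.2.1, x.2.2))) ≤ #T := card_image_le
      have h3 := card_union_le (T.image (fun x => (x.1, x.2.1, x.2.2, x.2.1)))
        (T.image (fun x => (x.2.1, x.1, x.2.1, x.2.2)))
      omega

/-- Supersaturation: a set `S` spanning substantially more than `|S| ^ (3 / 2)` edges spans
about as many 4-cycles as a random graph with that many edges. -/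
theorem innerDarts_sq_le_or_pow_four_le (S : Finset V) :
    innerDarts G S ^ 2 ≤ 4 * #S ^ 3 ∨
      innerDarts G S ^ 4 ≤ 2 * #S ^ 4 * #(fourCycleTuples G) := by
  have h1 := innerDarts_sq_le G S
  have h2 : innerWedges G S ^ 2 ≤ #S ^ 2 * (#(fourCycleTuples G) + 2 * innerWedges G S) := by
    calc innerWedges G S ^ 2 ≤
        #(S ×ˢ S) * ∑ p ∈ S ×ˢ S, #{v ∈ S | G.Adj p.1 v ∧ G.Adj v p.2} ^ 2 := by
          rw [innerWedges_eq_sum_codegree]; exact sq_sum_le_card_mul_sum_sq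
      _ ≤ _ := by
          rw [card_product, ← sq]
          exact Nat.mul_le_mul_left _ (sum_codegree_sq_le G S)
  set e := innerDarts G S
  set Q := innerWedges G S
  set N := #S
  set F := #(fourCycleTuples G)
  rcases le_total F (2 * Q) with h | h
  · left
    have hQ : Q ≤ 4 * N ^ 2 := by
      rcases Nat.eq_zero_or_pos Q with h0 | h0
      · simp [h0]
      · refine Nat.le_of_mul_le_mul_right (?_ : Q * Q ≤ 4 * N ^ 2 * Q) h0
        calc Q * Q = Q ^ 2 := by ring
          _ ≤ N ^ 2 * (F + 2 * Q) := h2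
          _ ≤ N ^ 2 * (2 * Q + 2 * Q) := by gcongr
          _ = 4 * N ^ 2 * Q := by ring
    calc e ^ 2 ≤ N * Q := h1
      _ ≤ N * (4 * N ^ 2) := by gcongr
      _ = 4 * N ^ 3 := by ring
  · right
    calc e ^ 4 = (e ^ 2) ^ 2 := by ring
      _ ≤ (N * Q) ^ 2 := by gcongr
      _ = N ^ 2 * Q ^ 2 := by ring
      _ ≤ N ^ 2 * (N ^ 2 * (F + 2 * Q)) := by gcongr
      _ ≤ N ^ 2 * (N ^ 2 * (F + F)) := by gcongr
      _ = 2 * N ^ 4 * F := by ring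

theorem innerDarts_le (S : Finset V) : innerDarts G S ≤ 2 * #G.edgeFinset := by
  rw [← G.sum_degrees_eq_twice_card_edges]
  calc innerDarts G S ≤ ∑ v ∈ S, G.degree v := by
        refine sum_le_sum fun v _ => card_le_card fun u hu => ?_
        simpa [G.adj_comm] using (mem_filter.1 hu).2
    _ ≤ _ := sum_le_sum_of_subset (subset_univ S)

theorem mul_card_degree_ge_le (θ : ℕ) :
    θ * #{v | θ ≤ G.degree v} ≤ 2 * #G.edgeFinset := by
  rw [← G.sum_degrees_eq_twice_card_edges]
  calc θ * #{v | θ ≤ G.degree v} = ∑ v with θ ≤ G.degree v, θ := by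
        rw [sum_const, smul_eq_mul, mul_comm]
    _ ≤ ∑ v with θ ≤ G.degree v, G.degree v := sum_le_sum fun v hv => (mem_filter.1 hv).2
    _ ≤ _ := sum_le_sum_of_subset (subset_univ _)

/-- Vertices of degree at least `θ` number at most `2 m / θ`, so supersaturation bounds the
number of edges they span. -/
theorem mul_innerDarts_degree_ge_le (θ : ℕ) :
    (θ : ℝ) * innerDarts G {v | θ ≤ G.degree v} ≤
      8192 * ((#G.edgeFinset : ℝ) ^ (4 / 3 : ℝ) + (fourCycles G).ncard) := by
  set m := #G.edgeFinset with hm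
  set S : Finset V := {v | θ ≤ G.degree v} with hS
  set t := (fourCycles G).ncard
  have hN : (θ : ℝ) * #S ≤ 2 * m := by exact_mod_cast mul_card_degree_ge_le G θ
  have he : (innerDarts G S : ℝ) ≤ 2 * m := by exact_mod_cast innerDarts_le G S
  have hF : (#(fourCycleTuples G) : ℝ) ≤ 256 * t := by exact_mod_cast card_fourCycleTuples_le G
  obtain ⟨y, hy0, hym⟩ : ∃ y : ℝ, 0 ≤ y ∧ y ^ 3 = m :=
    ⟨(m : ℝ) ^ (1 / 3 : ℝ), by positivity, by
      rw [← Real.rpow_natCast, ← Real.rpow_mul (by positivity)]; norm_num⟩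
  have hy4 : (m : ℝ) ^ (4 / 3 : ℝ) = y ^ 4 := by
    rw [← hym, ← Real.rpow_natCast, ← Real.rpow_natCast, ← Real.rpow_mul hy0]; norm_num
  -- with the cube root `y` of `m`, all bounds are polynomial
  rw [hy4]
  rw [← hym] at hN he
  have hor : (innerDarts G S : ℝ) ^ 2 ≤ 4 * (#S : ℝ) ^ 3 ∨
      (innerDarts G S : ℝ) ^ 4 ≤ 2 * (#S : ℝ) ^ 4 * #(fourCycleTuples G) := by
    exact_mod_cast innerDarts_sq_le_or_pow_four_le G S
  generalize (innerDarts G S : ℝ) = e at *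
  generalize hNN : (#S : ℝ) = N at *
  have hN0 : 0 ≤ N := hNN ▸ Nat.cast_nonneg _
  have hθ0 : (0 : ℝ) ≤ θ := Nat.cast_nonneg _
  generalize (θ : ℝ) = ϑ at *
  have hF0 : (0 : ℝ) ≤ #(fourCycleTuples G) := Nat.cast_nonneg _
  generalize (#(fourCycleTuples G) : ℝ) = F at *
  have ht0 : (0 : ℝ) ≤ t := Nat.cast_nonneg _
  generalize (t : ℝ) = τ at *
  have hy4' : 0 ≤ y ^ 4 := by positivity
  rcases le_total ϑ y with hsmall | hlarge
  · have : ϑ * e ≤ y * (2 * y ^ 3) := by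
      calc ϑ * e ≤ ϑ * (2 * y ^ 3) := by gcongr
        _ ≤ y * (2 * y ^ 3) := by gcongr
    nlinarith
  rcases le_total (ϑ * e) (y ^ 4) with hx | hx
  · linarith
  rcases hy0.eq_or_lt with rfl | hypos
  · have : ϑ * e ≤ ϑ * (2 * 0 ^ 3) := by gcongr
    norm_num at this ⊢
    linarith
  rcases hor with h | h
  · have h1 : y * (ϑ * e) ^ 2 ≤ y * (6 * y ^ 4) ^ 2 := by
      calc y * (ϑ * e) ^ 2 ≤ ϑ * (ϑ * e) ^ 2 := by gcongr
        _ = ϑ ^ 3 * e ^ 2 := by ring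
        _ ≤ ϑ ^ 3 * (4 * N ^ 3) := by gcongr
        _ = 4 * (ϑ * N) ^ 3 := by ring
        _ ≤ 4 * (2 * y ^ 3) ^ 3 := by gcongr
        _ = 32 * y ^ 9 := by ring
        _ ≤ 36 * y ^ 9 := by gcongr; norm_num
        _ = y * (6 * y ^ 4) ^ 2 := by ring
    have h2 := le_of_mul_le_mul_left h1 hypos
    have h3 : ϑ * e ≤ 6 * y ^ 4 := abs_le_of_sq_le_sq' h2 (by positivity) |>.2
    linarith
  · have h1 : y ^ 12 * (ϑ * e) ≤ y ^ 12 * (8192 * τ) := by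
      calc y ^ 12 * (ϑ * e) = (y ^ 4) ^ 3 * (ϑ * e) := by ring
        _ ≤ (ϑ * e) ^ 3 * (ϑ * e) := by
          have : 0 ≤ ϑ * e := hy4'.trans hx
          gcongr
        _ = ϑ ^ 4 * e ^ 4 := by ring
        _ ≤ ϑ ^ 4 * (2 * N ^ 4 * F) := by gcongr
        _ = 2 * (ϑ * N) ^ 4 * F := by ring
        _ ≤ 2 * (2 * y ^ 3) ^ 4 * (256 * τ) := by gcongr
        _ = y ^ 12 * (8192 * τ) := by ring
    have h2 := le_of_mul_le_mul_left h1 (by positivity)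
    linarith

/-- The sum of `min (deg a) (deg b)` over the edges `ab`, in the form in which it bounds the
running time: the darts are grouped by the binary logarithm of their smaller degree. -/
theorem sum_min_degree_le :
    ((∑ p : V × V with G.Adj p.1 p.2 ∧ G.degree p.1 ≤ G.degree p.2, G.degree p.1 : ℕ) : ℝ) ≤
      16384 * (Nat.log 2 (2 * #G.edgeFinset) + 1) *
        ((#G.edgeFinset : ℝ) ^ (4 / 3 : ℝ) + (fourCycles G).ncard) := by
  set k := Nat.log 2 (2 * #G.edgeFinset) with hk
  have hpt : ∀ p ∈ ({p | G.Adj p.1 p.2 ∧ G.degree p.1 ≤ G.degree p.2} : Finset (V × V)),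
      G.degree p.1 ≤ ∑ i ∈ range (k + 1),
        if 2 ^ i ≤ G.degree p.1 ∧ 2 ^ i ≤ G.degree p.2 then 2 ^ (i + 1) else 0 := by
    rintro ⟨a, b⟩ hp
    obtain ⟨hab, hle⟩ := (mem_filter.1 hp).2
    simp only at hab hle ⊢
    have hpos : 0 < G.degree a := (G.degree_pos_iff_exists_adj a).2 ⟨b, hab⟩
    have hi : Nat.log 2 (G.degree a) ∈ range (k + 1) := by
      rw [mem_range, Nat.lt_succ_iff]
      refine Nat.log_mono_right ?_
      rw [← G.sum_degrees_eq_twice_card_edges]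
      exact single_le_sum (f := fun v => G.degree v) (fun _ _ => Nat.zero_le _) (mem_univ a)
    have h2 : 2 ^ Nat.log 2 (G.degree a) ≤ G.degree a := Nat.pow_log_le_self 2 hpos.ne'
    refine le_trans ?_ (single_le_sum (fun _ _ => Nat.zero_le _) hi)
    rw [if_pos ⟨h2, h2.trans hle⟩]
    exact (Nat.lt_pow_succ_log_self (by norm_num) _).le
  have hsum : ∑ p : V × V with G.Adj p.1 p.2 ∧ G.degree p.1 ≤ G.degree p.2, G.degree p.1 ≤
      ∑ i ∈ range (k + 1), 2 ^ (i + 1) * innerDarts G {v | 2 ^ i ≤ G.degree v} := by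
    refine (sum_le_sum hpt).trans ?_
    rw [sum_comm]
    refine sum_le_sum fun i _ => ?_
    rw [← sum_filter, sum_const, smul_eq_mul, mul_comm]
    refine Nat.mul_le_mul_left _ ?_
    have : innerDarts G {v | 2 ^ i ≤ G.degree v} = #{p : V × V |
        (2 ^ i ≤ G.degree p.2) ∧ (2 ^ i ≤ G.degree p.1) ∧ G.Adj p.1 p.2} := by
      rw [innerDarts, ← card_sigma]
      refine card_bij (fun x _ => (x.2, x.1)) ?_ ?_ ?_
      · rintro ⟨v, u⟩ h
        simp at h
        simp [h]
      · rintro ⟨v, u⟩ _ ⟨v', u'⟩ _ h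
        simp at h
        simp [h]
      · rintro ⟨a, b⟩ h
        simp at h
        exact ⟨⟨b, a⟩, by simp [h], rfl⟩
    rw [this]
    refine card_le_card ?_
    rintro ⟨a, b⟩ h
    simp at h ⊢
    tauto
  calc ((∑ p : V × V with G.Adj p.1 p.2 ∧ G.degree p.1 ≤ G.degree p.2, G.degree p.1 : ℕ) : ℝ)
      ≤ ((∑ i ∈ range (k + 1), 2 ^ (i + 1) * innerDarts G {v | 2 ^ i ≤ G.degree v} : ℕ) : ℝ) := by
        exact_mod_cast hsum
    _ = ∑ i ∈ range (k + 1),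
        2 * (((2 ^ i : ℕ) : ℝ) * innerDarts G {v | 2 ^ i ≤ G.degree v}) := by
        push_cast
        refine sum_congr rfl fun i _ => ?_
        ring
    _ ≤ ∑ i ∈ range (k + 1),
        2 * (8192 * ((#G.edgeFinset : ℝ) ^ (4 / 3 : ℝ) + (fourCycles G).ncard)) := by
        refine sum_le_sum fun i _ => ?_
        exact mul_le_mul_of_nonneg_left (mul_innerDarts_degree_ge_le G (2 ^ i)) zero_le_two
    _ = _ := by
        rw [sum_const, card_range, nsmul_eq_mul]
        push_cast
        ring

end Counting

/-! ### Amortized total correctness of word RAM programs -/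

namespace WordRAM

/-- `Reaches w p s Q B`: started in `s`, the program `p` halts in a state satisfying `Q`, after at
most `B` steps plus three steps for every word it has written to the output. The bound `B` may be
negative: a program that writes much output has credit left over. -/
def Reaches (w : ℕ) (p : Program) (s : State) (Q : State → Prop) (B : ℤ) : Prop :=
  ∃ (s' : State) (T : ℕ), Runs w p s s' T ∧ Q s' ∧
    (T : ℤ) + 3 * s.out.length ≤ B + 3 * s'.out.length

theorem Reaches.mono {w : ℕ} {p : Program} {s : State} {Q Q' : State → Prop} {B B' : ℤ}
    (h : Reaches w p s Q B) (hQ : ∀ s', Q s' → Q' s') (hB : B ≤ B') : Reaches w p s Q' B' := by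
  obtain ⟨s', T, h1, h2, h3⟩ := h
  exact ⟨s', T, h1, hQ _ h2, by omega⟩

theorem Reaches.seq {w : ℕ} {p q : Program} {s : State} {Q R : State → Prop} {B B' : ℤ}
    (h : Reaches w p s Q B) (h' : ∀ s', Q s' → Reaches w q s' R B') :
    Reaches w (.seq p q) s R (B + B') := by
  obtain ⟨s₁, T₁, h1, h2, h3⟩ := h
  obtain ⟨s₂, T₂, h4, h5, h6⟩ := h' s₁ h2
  exact ⟨s₂, _, .seq h1 h4, h5, by push_cast; omega⟩

theorem Reaches.cond_true {w : ℕ} {b : Test} {p q : Program} {s : State} {Q : State → Prop}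
    {B : ℤ} (hb : b.Holds s) (h : Reaches w p s Q B) : Reaches w (.cond b p q) s Q (1 + B) := by
  obtain ⟨s', T, h1, h2, h3⟩ := h
  exact ⟨s', _, .cond_true hb h1, h2, by push_cast; omega⟩

theorem Reaches.cond_false {w : ℕ} {b : Test} {p q : Program} {s : State} {Q : State → Prop}
    {B : ℤ} (hb : ¬ b.Holds s) (h : Reaches w q s Q B) : Reaches w (.cond b p q) s Q (1 + B) := by
  obtain ⟨s', T, h1, h2, h3⟩ := h
  exact ⟨s', _, .cond_false hb h1, h2, by push_cast; omega⟩

theorem Reaches.skip {w : ℕ} {s : State} {Q : State → Prop} (h : Q s) :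
    Reaches w .skip s Q 1 := ⟨s, 1, .skip s, h, by simp⟩

/-- A loop that works through a list: `I d t` is its invariant when the elements of `d` are done
and those of `t` are still to do. The cost of an element includes that of the test. -/
theorem Reaches.loop {w : ℕ} {b : Test} {p : Program} {α : Type*}
    (I : List α → List α → State → Prop) (cost : α → ℤ) (l : List α)
    (hend : ∀ s, I l [] s → ¬ b.Holds s)
    (hstep : ∀ d x t s, d ++ x :: t = l → I d (x :: t) s →
      b.Holds s ∧ Reaches w p s (I (d ++ [x]) t) (cost x - 1))
    {s : State} (h : I [] l s) :
    Reaches w (.loop b p) s (I l []) (1 + (l.map cost).sum) := by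
  suffices H : ∀ t d s, d ++ t = l → I d t s →
      Reaches w (.loop b p) s (I l []) (1 + (t.map cost).sum) from H l [] s rfl h
  intro t
  induction t with
  | nil =>
    intro d s hd hI
    obtain rfl : d = l := by simpa using hd
    exact ⟨s, 1, .loop_false (hend s hI), hI, by simp⟩
  | cons x t ih =>
    intro d s hd hI
    obtain ⟨hb, s₁, T₁, h1, h2, h3⟩ := hstep d x t s hd hI
    obtain ⟨s₂, T₂, h4, h5, h6⟩ := ih (d ++ [x]) s₁ (by simpa using hd) h2
    exact ⟨s₂, _, .loop_true hb h1 h4, h5, by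
      rw [List.map_cons, List.sum_cons]; push_cast; omega⟩

/-- Straight-line code. -/
def Program.block : List Instr → Program
  | [] => .skip
  | i :: l => .seq (.instr i) (Program.block l)

/-- The effect of straight-line code. -/
def execs (w : ℕ) : List Instr → State → State
  | [], s => s
  | i :: l, s => execs w l (i.exec w s)

theorem runs_block (w : ℕ) (l : List Instr) (s : State) :
    Runs w (.block l) s (execs w l s) (l.length + 1) := by
  induction l generalizing s with
  | nil => exact .skip s
  | cons i l ih =>
    have := Runs.seq (.instr i s) (ih (i.exec w s))
    rwa [add_comm 1] at this

theorem Reaches.block {w : ℕ} {l : List Instr} {s : State} {Q : State → Prop} {B : ℤ}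
    (hQ : Q (execs w l s))
    (hB : (l.length : ℤ) + 1 + 3 * s.out.length ≤ B + 3 * (execs w l s).out.length) :
    Reaches w (.block l) s Q B :=
  ⟨_, _, runs_block w l s, hQ, by push_cast; omega⟩

theorem sub_one_word {w k : ℕ} (h : k + 1 < 2 ^ w) : (k + 1 + (2 ^ w - 1 % 2 ^ w)) % 2 ^ w = k := by
  rw [Nat.mod_eq_of_lt (a := 1) (by omega), show k + 1 + (2 ^ w - 1) = k + 2 ^ w by omega,
    Nat.add_mod_right, Nat.mod_eq_of_lt (by omega)]

/-! ### Linked lists in memory -/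

/-- `IsLinkedList next h l`: from the head pointer `h`, the pointers `next` run through the list
`l`. The pointer to `k` is `k + 1`, and the null pointer is `0`. -/
def IsLinkedList (next : ℕ → ℕ) : ℕ → List ℕ → Prop
  | h, [] => h = 0
  | h, k :: l => h = k + 1 ∧ IsLinkedList next (next k) l

theorem IsLinkedList.update {next : ℕ → ℕ} {h : ℕ} {l : List ℕ} (H : IsLinkedList next h l)
    {q : ℕ} (hq : q ∉ l) (y : ℕ) : IsLinkedList (Function.update next q y) h l := by
  induction l generalizing h with
  | nil => exact H
  | cons k l ih =>
    simp only [List.mem_cons, not_or] at hq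
    refine ⟨H.1, ?_⟩
    rw [Function.update_of_ne (Ne.symm hq.1)]
    exact ih H.2 hq.2

theorem IsLinkedList.cons {next : ℕ → ℕ} {h : ℕ} {l : List ℕ} (H : IsLinkedList next h l)
    {q : ℕ} (hq : q ∉ l) : IsLinkedList (Function.update next q h) (q + 1) (q :: l) :=
  ⟨rfl, by rw [Function.update_self]; exact H.update hq h⟩

/-! ### The layout of the memory -/

/-- The memory holding three arrays of length `M` and then four arrays of length `n`:
the input `x`, the links `nx` of the adjacency lists, the links `wn` of the wedge lists,
the heads `hd` of the adjacency lists, the degrees `dg`, the stamps `st` of the wedge lists and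
the heads `wh` of the wedge lists. -/
def layout (M n : ℕ) (x nx wn hd dg st wh : ℕ → ℕ) (i : ℕ) : ℕ :=
  if i < M then x i
  else if i < 2 * M then nx (i - M)
  else if i < 3 * M then wn (i - 2 * M)
  else if i < 3 * M + n then hd (i - 3 * M)
  else if i < 3 * M + 2 * n then dg (i - (3 * M + n))
  else if i < 3 * M + 3 * n then st (i - (3 * M + 2 * n))
  else wh (i - (3 * M + 3 * n))

section Layout

variable {M n : ℕ} {x nx wn hd dg st wh : ℕ → ℕ} {i : ℕ}

theorem layout_x (h : i < M) : layout M n x nx wn hd dg st wh i = x i := by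
  simp [layout, h]

theorem layout_nx (h : i < M) : layout M n x nx wn hd dg st wh (M + i) = nx i := by
  rw [layout, if_neg (by omega), if_pos (by omega), Nat.add_sub_cancel_left]

theorem layout_wn (h : i < M) : layout M n x nx wn hd dg st wh (2 * M + i) = wn i := by
  rw [layout, if_neg (by omega), if_neg (by omega), if_pos (by omega), Nat.add_sub_cancel_left]

theorem layout_hd (h : i < n) : layout M n x nx wn hd dg st wh (3 * M + i) = hd i := by
  rw [layout, if_neg (by omega), if_neg (by omega), if_neg (by omega), if_pos (by omega),
    Nat.add_sub_cancel_left]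

theorem layout_dg (h : i < n) : layout M n x nx wn hd dg st wh (3 * M + n + i) = dg i := by
  rw [layout, if_neg (by omega), if_neg (by omega), if_neg (by omega), if_neg (by omega),
    if_pos (by omega), Nat.add_sub_cancel_left]

theorem layout_st (h : i < n) : layout M n x nx wn hd dg st wh (3 * M + 2 * n + i) = st i := by
  rw [layout, if_neg (by omega), if_neg (by omega), if_neg (by omega), if_neg (by omega),
    if_neg (by omega), if_pos (by omega), Nat.add_sub_cancel_left]

theorem layout_wh : layout M n x nx wn hd dg st wh (3 * M + 3 * n + i) = wh i := by
  rw [layout, if_neg (by omega), if_neg (by omega), if_neg (by omega), if_neg (by omega),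
    if_neg (by omega), if_neg (by omega), Nat.add_sub_cancel_left]

variable {y : ℕ}

theorem update_layout_nx (h : i < M) : Function.update (layout M n x nx wn hd dg st wh) (M + i) y =
    layout M n x (Function.update nx i y) wn hd dg st wh := by
  funext j
  simp only [layout, Function.update_apply]
  split_ifs <;> first | rfl | omega

theorem update_layout_wn (h : i < M) :
    Function.update (layout M n x nx wn hd dg st wh) (2 * M + i) y =
      layout M n x nx (Function.update wn i y) hd dg st wh := by
  funext j
  simp only [layout, Function.update_apply]
  split_ifs <;> first | rfl | omega

theorem update_layout_hd (h : i < n) :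
    Function.update (layout M n x nx wn hd dg st wh) (3 * M + i) y =
      layout M n x nx wn (Function.update hd i y) dg st wh := by
  funext j
  simp only [layout, Function.update_apply]
  split_ifs <;> first | rfl | omega

theorem update_layout_dg (h : i < n) :
    Function.update (layout M n x nx wn hd dg st wh) (3 * M + n + i) y =
      layout M n x nx wn hd (Function.update dg i y) st wh := by
  funext j
  simp only [layout, Function.update_apply]
  split_ifs <;> first | rfl | omega

theorem update_layout_st (h : i < n) :
    Function.update (layout M n x nx wn hd dg st wh) (3 * M + 2 * n + i) y =
      layout M n x nx wn hd dg (Function.update st i y) wh := by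
  funext j
  simp only [layout, Function.update_apply]
  split_ifs <;> first | rfl | omega

theorem update_layout_wh :
    Function.update (layout M n x nx wn hd dg st wh) (3 * M + 3 * n + i) y =
      layout M n x nx wn hd dg st (Function.update wh i y) := by
  funext j
  simp only [layout, Function.update_apply]
  split_ifs <;> first | rfl | omega

end Layout

/-- The registers below `10` hold `n`, the constants `1` and `0`, and the addresses of the
arrays. -/
structure BaseRegs (M n : ℕ) (r : ℕ → ℕ) : Prop where
  r0 : r 0 = n
  r2 : r 2 = 1
  r3 : r 3 = M
  r4 : r 4 = 2 * M
  r5 : r 5 = 3 * M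
  r6 : r 6 = 3 * M + n
  r7 : r 7 = 3 * M + 2 * n
  r8 : r 8 = 3 * M + 3 * n
  r9 : r 9 = 0

theorem BaseRegs.congr {M n : ℕ} {r r' : ℕ → ℕ} (h : BaseRegs M n r)
    (hr : ∀ i < 10, r' i = r i) : BaseRegs M n r' := by
  constructor <;> rw [hr _ (by norm_num)]
  exacts [h.r0, h.r2, h.r3, h.r4, h.r5, h.r6, h.r7, h.r8, h.r9]

open Instr

/-! ### Adjacency lists and wedges -/

section Model

variable (M : ℕ) (x : ℕ → ℕ)

/-- The endpoint of the half-edge `j` other than its source `x j`: the two halves of an edge are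
stored in the cells `2 i` and `2 i + 1`. -/
def tgt (j : ℕ) : ℕ := x (j ^^^ 1)

/-- The half-edges below `M` that start in `v`, the last one first. -/
def adj (v : ℕ) : List ℕ := ((List.range M).filter (x · = v)).reverse

/-- Vertices ordered by degree, and by their numbers among those of the same degree. -/
def Before (a v : ℕ) : Prop :=
  (adj M x a).length < (adj M x v).length ∨ (adj M x a).length = (adj M x v).length ∧ a < v

instance (a v : ℕ) : Decidable (Before M x a v) := inferInstanceAs (Decidable (_ ∨ _))

/-- The second halves of the paths of length two that start with the half-edge `p` and go from
its source `v` to vertices before `v`. -/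
def wedgesVia (v p : ℕ) : List ℕ :=
  if Before M x (tgt x p) v then (adj M x (tgt x p)).filter (fun q => Before M x (tgt x q) v)
  else []

/-- The second halves of the paths of length two that start with a half-edge in `d`. -/
def wedges (v : ℕ) (d : List ℕ) : List ℕ := d.flatMap (wedgesVia M x v)

/-- The pairs of an element `q` of the list and a later element `r` with the same target. -/
def wedgePairs : List ℕ → List (ℕ × ℕ)
  | [] => []
  | q :: l => wedgePairs l ++ (l.filter (fun r => tgt x r = tgt x q)).map (fun r => (q, r))

/-- The words written for a pair of wedges that start in `v`. -/
def outWords (v : ℕ) (p : ℕ × ℕ) : List ℕ := [v, x p.1, tgt x p.1, x p.2]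

/-- The pairs of wedges that start in `v`. -/
def pairsAt (v : ℕ) : List (ℕ × ℕ) := wedgePairs x (wedges M x v (adj M x v)).reverse

/-- The words written when the half-edge `j` is the current one: a vertex is treated when the
first half-edge in its adjacency list comes up. -/
def outAt (j : ℕ) : List ℕ :=
  if (adj M x (x j)).head? = some j then (pairsAt M x (x j)).flatMap (outWords x (x j)) else []

/-- The time charged to a half-edge `p` starting in `v`. A wedge via `p` takes at most `31` steps,
not counting the output; the fixed cost of taking up the target of `p`, which has at least one
half-edge, is absorbed in the larger factor. -/
def edgeCost (v p : ℕ) : ℤ :=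
  19 + if Before M x (tgt x p) v then 50 * (adj M x (tgt x p)).length else 0

/-- The time charged when the half-edge `j` is the current one: apart from a constant, only if a
vertex is treated. -/
def costAt (j : ℕ) : ℤ :=
  20 + if (adj M x (x j)).head? = some j then ((adj M x (x j)).map (edgeCost M x (x j))).sum else 0

variable {M x}

theorem mem_adj {v j : ℕ} : j ∈ adj M x v ↔ j < M ∧ x j = v := by simp [adj]

theorem nodup_adj (v : ℕ) : (adj M x v).Nodup :=
  List.nodup_reverse.2 (List.nodup_range.filter _)

theorem adj_succ (i v : ℕ) : adj (i + 1) x v = if x i = v then i :: adj i x v else adj i x v := by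
  by_cases h : x i = v <;> simp [adj, List.range_succ, h]

theorem length_adj_le (v : ℕ) : (adj M x v).length ≤ M := by
  simpa [adj] using List.length_filter_le (fun j => decide (x j = v)) (List.range M)

theorem mem_wedges {v q : ℕ} {d : List ℕ} : q ∈ wedges M x v d ↔
    ∃ p ∈ d, Before M x (tgt x p) v ∧ q < M ∧ x q = tgt x p ∧ Before M x (tgt x q) v := by
  simp only [wedges, wedgesVia, List.mem_flatMap]
  refine exists_congr fun p => and_congr_right fun _ => ?_
  split_ifs with h <;> simp [h, mem_adj, and_assoc]

end Model

/-! ### The program -/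

/-- Sets up the constant registers. -/
def setup : Program := .block
  [const 2 1, op .add 3 1 1, op .add 4 3 3, op .add 5 4 3, op .add 6 5 0, op .add 7 6 0,
    op .add 8 7 0]

/-- Inserts the half-edge in register `10` into the adjacency list of its source, and moves on to
the next half-edge. -/
def insertEdge : Program := .block
  [load 11 10, op .add 12 5 11, load 13 12, op .add 14 3 10, store 14 13, op .add 10 10 2,
    store 12 10, op .add 12 6 11, load 13 12, op .add 13 13 2, store 12 13]

/-- Builds the adjacency lists. -/
def build : Program := .loop (.lt 10 3) insertEdge

/-- Register `21` becomes `1` if the vertex in register `a`, whose degree is in register `20`, is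
before the vertex in register `11`, whose degree is in register `13`; otherwise `0`. -/
def compare (a : ℕ) : Program :=
  .cond (.lt 20 13) (.instr (const 21 1))
    (.cond (.eq 20 13) (.cond (.lt a 11) (.instr (const 21 1)) (.instr (const 21 0)))
      (.instr (const 21 0)))

/-- Runs through the wedge list with head pointer in register `18`, and writes a 4-cycle for each
element. -/
def report : Program := .loop (.ne 18 9) (.block
  [op .sub 18 18 2, load 23 18, emit 11, emit 14, emit 17, emit 23, op .add 19 4 18, load 18 19])

/-- Treats the wedge from `v` via `a` to `u` (registers `11`, `14` and `17`) that ends with the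
half-edge in register `16`: empties the wedge list of `u` if it does not carry the current stamp,
reports the 4-cycles formed with the elements of the list, and inserts the wedge. -/
def treatWedge : Program :=
  .seq (.block [op .add 19 7 17, load 20 19, op .add 22 8 17])
    (.seq (.cond (.ne 20 10) (.block [store 19 10, store 22 9]) .skip)
      (.seq (.block [load 18 22, op .add 19 4 16, store 19 18])
        (.seq report
          (.block [op .add 22 8 17, op .add 16 16 2, store 22 16]))))

/-- Treats the wedges from the vertex in register `11` via the vertex in register `14`. -/
def treatMiddle : Program :=
  .seq (.block [op .add 19 5 14, load 15 19])
    (.loop (.ne 15 9)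
      (.seq (.block [op .sub 16 15 2, op .xor 19 16 2, load 17 19, op .add 19 3 16, load 15 19,
          op .add 19 6 17, load 20 19])
        (.seq (compare 17) (.cond (.eq 21 2) treatWedge .skip))))

/-- Treats the wedges from the vertex in register `11`, with the head of its adjacency list in
register `12`. -/
def treatVertex : Program :=
  .seq (.block [op .add 19 6 11, load 13 19])
    (.loop (.ne 12 9)
      (.seq (.block [op .sub 16 12 2, op .xor 19 16 2, load 14 19, op .add 19 3 16, load 12 19,
          op .add 19 6 14, load 20 19])
        (.seq (compare 14) (.cond (.eq 21 2) treatMiddle .skip))))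

/-- Lists all 4-cycles: every vertex is treated at the half-edge its adjacency list starts with.
Register `10` runs through the half-edges and, increased by `1`, serves as the stamp; `11` holds
the vertex `v` that is treated, `12` a pointer into its adjacency list and `13` its degree; `14`
holds the middle vertex and `15` a pointer into its adjacency list; `16` holds the second half-edge
of the wedge and `17` its target `u`; `18` is a pointer into the wedge list of `u`. The registers
from `19` on are for temporary values. -/
def listFourCycles : Program :=
  .seq setup (.seq build (.seq (.block [const 10 0])
    (.loop (.lt 10 3)
      (.seq (.block [load 11 10, op .add 19 5 11, load 12 19, op .add 10 10 2])
        (.cond (.eq 12 10) treatVertex .skip)))))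

/-! ### Building the adjacency lists -/

section Verification

variable {w M n : ℕ} {x : ℕ → ℕ}

theorem reaches_build (hW : 3 * M + 4 * n + 2 ≤ 2 ^ w) (hx : ∀ j < M, x j < n) {s : State}
    (hb : BaseRegs M n s.reg) (h10 : s.reg 10 = 0)
    (hmem : s.mem = layout M n x 0 0 0 0 0 0) :
    Reaches w build s (fun s' => BaseRegs M n s'.reg ∧ s'.out = s.out ∧
      ∃ nx hd, s'.mem = layout M n x nx 0 hd (fun v => (adj M x v).length) 0 0 ∧
        ∀ v, IsLinkedList nx (hd v) (adj M x v)) (1 + 13 * M) := by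
  have key := Reaches.loop (w := w) (b := .lt 10 3) (p := insertEdge)
    (fun d (_ : List ℕ) s' => BaseRegs M n s'.reg ∧ s'.reg 10 = d.length ∧ s'.out = s.out ∧
      ∃ nx hd, s'.mem = layout M n x nx 0 hd (fun v => (adj d.length x v).length) 0 0 ∧
        ∀ v, IsLinkedList nx (hd v) (adj d.length x v)) (fun _ => 13) (List.range M)
    ?_ ?_ (s := s) ⟨hb, h10, rfl, 0, 0, ?_, ?_⟩
  · refine key.mono ?_ ?_
    · rintro s' ⟨h1, -, h3, nx, hd, h4, h5⟩
      simp only [List.length_range] at h4 h5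
      exact ⟨h1, h3, nx, hd, h4, h5⟩
    · simp [mul_comm]
  · rintro s' ⟨h1, h2, -⟩
    simp [Test.Holds, h1.r3, h2]
  · rintro d y t s' hd ⟨h1, h2, h3, nx, hd', h4, h5⟩
    have hlt : d.length < M := by
      have := congrArg List.length hd
      simp at this
      omega
    simp only [List.length_append, List.length_singleton]
    generalize d.length = i at *
    have hxi := hx i hlt
    have hlen : (adj i x (x i)).length ≤ i := length_adj_le _
    refine ⟨by simp [Test.Holds, h1.r3, h2, hlt], ?_⟩
    have e1 : (3 * M + x i) % 2 ^ w = 3 * M + x i := Nat.mod_eq_of_lt (by omega)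
    have e2 : (M + i) % 2 ^ w = M + i := Nat.mod_eq_of_lt (by omega)
    have e3 : (i + 1) % 2 ^ w = i + 1 := Nat.mod_eq_of_lt (by omega)
    have e4 : (3 * M + n + x i) % 2 ^ w = 3 * M + n + x i := Nat.mod_eq_of_lt (by omega)
    have e5 : ((adj i x (x i)).length + 1) % 2 ^ w = (adj i x (x i)).length + 1 :=
      Nat.mod_eq_of_lt (by omega)
    refine Reaches.block ⟨?_, ?_, ?_, Function.update nx i (hd' (x i)),
      Function.update hd' (x i) (i + 1), ?_, ?_⟩ ?_
    · refine h1.congr fun k hk => ?_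
      simp (disch := omega) [execs, exec, Function.update_of_ne]
    · simp [execs, exec, BinOp.eval, h2, h1.r2, e3]
    · simpa [execs, exec] using h3
    · simp [execs, exec, BinOp.eval, h2, h1.r2, h1.r3, h1.r5, h1.r6, h4, layout_x hlt, e1, e2, e3,
        e4, e5, layout_hd hxi, layout_dg hxi, update_layout_nx hlt, update_layout_hd hxi,
        update_layout_dg hxi]
      congr 1
      funext v
      rw [adj_succ, Function.update_apply]
      by_cases hv : v = x i
      · simp [hv]
      · simp [hv, Ne.symm hv]
    · intro v
      have hni : ∀ v, i ∉ adj i x v := fun v h => absurd (mem_adj.1 h).1 (lt_irrefl i)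
      rw [adj_succ]
      by_cases hv : v = x i
      · subst hv
        simpa using (h5 (x i)).cons (hni (x i))
      · rw [Function.update_of_ne hv, if_neg (Ne.symm hv)]
        exact (h5 v).update (hni v) _
    · simp [execs, exec]
  · simp [hmem, adj]
    rfl
  · intro v
    simp [adj, IsLinkedList]

/-! ### Listing the cycles -/

/-- The wedge lists at the time when `R` lists the wedges that start in the current vertex, the
last one first: a list that carries the current stamp `tag` holds the wedges that end in its
vertex, and a list with an older stamp is obsolete. -/
def WedgeLists (x : ℕ → ℕ) (tag : ℕ) (R : List ℕ) (wn st wh : ℕ → ℕ) : Prop :=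
  ∀ u, (st u = tag ∧ IsLinkedList wn (wh u) (R.filter (fun r => tgt x r = u))) ∨
    (st u < tag ∧ R.filter (fun r => tgt x r = u) = [])

/-- The state in which the vertex `v` is treated with the stamp `tag`, and its wedges in `R`, the
last one first, have been inserted. -/
structure Treating (M n : ℕ) (x nx hd : ℕ → ℕ) (o : List ℕ) (v tag : ℕ) (R : List ℕ)
    (s : State) : Prop where
  base : BaseRegs M n s.reg
  r10 : s.reg 10 = tag
  r11 : s.reg 11 = v
  out : s.out = o ++ (wedgePairs x R).flatMap (outWords x v)
  mem : ∃ wn st wh, s.mem = layout M n x nx wn hd (fun v => (adj M x v).length) st wh ∧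
    WedgeLists x tag R wn st wh

theorem Treating.congr {nx hd : ℕ → ℕ} {o : List ℕ} {v tag : ℕ} {R : List ℕ} {s s' : State}
    (h : Treating M n x nx hd o v tag R s) (hr : ∀ i < 12, s'.reg i = s.reg i)
    (ho : s'.out = s.out) (hm : s'.mem = s.mem) : Treating M n x nx hd o v tag R s' where
  base := h.base.congr fun i hi => hr i (by omega)
  r10 := (hr 10 (by norm_num)).trans h.r10
  r11 := (hr 11 (by norm_num)).trans h.r11
  out := ho.trans h.out
  mem := by rw [hm]; exact h.mem

theorem reaches_compare (hw : 1 < 2 ^ w) {a : ℕ} {s : State}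
    (h13 : s.reg 13 = (adj M x (s.reg 11)).length) (h20 : s.reg 20 = (adj M x (s.reg a)).length) :
    Reaches w (compare a) s (fun s' => s' = { s with
      reg := Function.update s.reg 21 (if Before M x (s.reg a) (s.reg 11) then 1 else 0) }) 4 := by
  have hinstr : ∀ k, Reaches w (.instr (const 21 k)) s
      (fun s' => s' = { s with reg := Function.update s.reg 21 (k % 2 ^ w) }) 1 :=
    fun k => ⟨_, 1, .instr _ _, rfl, by simp [exec]⟩
  have h1 := hinstr 1
  have h0 := hinstr 0
  rw [Nat.mod_eq_of_lt hw] at h1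
  rw [Nat.zero_mod] at h0
  by_cases hlt : s.reg 20 < s.reg 13
  · have hB : Before M x (s.reg a) (s.reg 11) := Or.inl (by omega)
    rw [if_pos hB]
    exact (Reaches.cond_true (b := .lt 20 13) hlt h1).mono (fun _ h => h) (by norm_num)
  by_cases heq : s.reg 20 = s.reg 13
  · by_cases hav : s.reg a < s.reg 11
    · have hB : Before M x (s.reg a) (s.reg 11) := Or.inr ⟨by omega, hav⟩
      rw [if_pos hB]
      exact (Reaches.cond_false (b := .lt 20 13) hlt (Reaches.cond_true (b := .eq 20 13) heq (Reaches.cond_true (b := .lt a 11) hav h1))).mono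
        (fun _ h => h) (by norm_num)
    · have hB : ¬ Before M x (s.reg a) (s.reg 11) := by unfold Before; omega
      rw [if_neg hB]
      exact (Reaches.cond_false (b := .lt 20 13) hlt (Reaches.cond_true (b := .eq 20 13) heq (Reaches.cond_false (b := .lt a 11) hav h0))).mono
        (fun _ h => h) (by norm_num)
  · have hB : ¬ Before M x (s.reg a) (s.reg 11) := by unfold Before; omega
    rw [if_neg hB]
    exact (Reaches.cond_false (b := .lt 20 13) hlt (Reaches.cond_false (b := .eq 20 13) heq h0)).mono (fun _ h => h) (by norm_num)

/-- Running through a wedge list is paid for by the words that are written. -/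
theorem reaches_report (hW : 3 * M + 4 * n + 2 ≤ 2 ^ w) {nx wn hd dg st wh : ℕ → ℕ} {s : State}
    {l : List ℕ} (hb : BaseRegs M n s.reg) (hmem : s.mem = layout M n x nx wn hd dg st wh)
    (hl : IsLinkedList wn (s.reg 18) l) (hlM : ∀ r ∈ l, r < M) :
    Reaches w report s (fun s' => (∀ i < 18, s'.reg i = s.reg i) ∧ s'.mem = s.mem ∧
      s'.out = s.out ++ l.flatMap (fun r => [s.reg 11, s.reg 14, s.reg 17, x r])) 1 := by
  refine (Reaches.loop (fun d t s' => (∀ i < 18, s'.reg i = s.reg i) ∧ s'.mem = s.mem ∧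
      s'.out = s.out ++ d.flatMap (fun r => [s.reg 11, s.reg 14, s.reg 17, x r]) ∧
      IsLinkedList wn (s'.reg 18) t) (fun _ => 0) l ?_ ?_
      ⟨fun _ _ => rfl, rfl, by simp, hl⟩).mono (fun s' h => ⟨h.1, h.2.1, h.2.2.1⟩) (by simp)
  · rintro s' ⟨h1, -, -, h4⟩
    simp only [IsLinkedList] at h4
    simp [Test.Holds, h4, h1 9, hb.r9]
  · rintro d r t s' hd ⟨h1, h2, h3, h4, h5⟩
    have hr : r < M := hlM r (by simp [← hd])
    have e1 : (r + 1 + (2 ^ w - 1 % 2 ^ w)) % 2 ^ w = r := sub_one_word (by omega)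
    have e2 : (2 * M + r) % 2 ^ w = 2 * M + r := Nat.mod_eq_of_lt (by omega)
    rw [hmem] at h2
    refine ⟨by simp [Test.Holds, h4, h1 9, hb.r9], Reaches.block ⟨?_, ?_, ?_, ?_⟩ ?_⟩
    · intro i hi
      simp (disch := omega) [execs, exec, Function.update_of_ne, h1]
    · simp [execs, exec, h2, hmem]
    · simp [execs, exec, BinOp.eval, h1, h2, h3, h4, hb.r2, e1, layout_x hr]
    · simpa [execs, exec, BinOp.eval, h1, h2, h3, h4, hb.r2, hb.r4, e1, e2, layout_wn hr] using h5
    · simp [execs, exec]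
      omega

variable {nx hd : ℕ → ℕ} {o : List ℕ} {v tag : ℕ}

theorem reaches_treatWedge (hW : 3 * M + 4 * n + 2 ≤ 2 ^ w) {R : List ℕ} {q : ℕ} {s : State}
    (h : Treating M n x nx hd o v tag R s) (h14 : s.reg 14 = x q) (h16 : s.reg 16 = q)
    (h17 : s.reg 17 = tgt x q) (hq : q < M) (hu : tgt x q < n) (hqR : q ∉ R)
    (hR : ∀ r ∈ R, r < M) :
    Reaches w treatWedge s (fun s' => (∀ i < 16, s'.reg i = s.reg i) ∧
      Treating M n x nx hd o v tag (q :: R) s') 17 := by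
  obtain ⟨hb, h10, h11, ho, wn, st, wh, hmem, hwl⟩ := h
  set u := tgt x q with hu'
  have e1 : (3 * M + 2 * n + u) % 2 ^ w = 3 * M + 2 * n + u := Nat.mod_eq_of_lt (by omega)
  have e2 : (3 * M + 3 * n + u) % 2 ^ w = 3 * M + 3 * n + u := Nat.mod_eq_of_lt (by omega)
  have e3 : (2 * M + q) % 2 ^ w = 2 * M + q := Nat.mod_eq_of_lt (by omega)
  have e4 : (q + 1) % 2 ^ w = q + 1 := Nat.mod_eq_of_lt (by omega)
  set l := R.filter (fun r => tgt x r = u) with hl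
  have hlM : ∀ r ∈ l, r < M := fun r hr => hR r (List.mem_filter.1 hr).1
  have hql : q ∉ l := fun hr => hqR (List.mem_filter.1 hr).1
  refine Reaches.mono (B := 4 + (4 + (4 + (1 + 4)))) ?_ (fun _ h => h) (by norm_num)
  refine Reaches.seq (Q := fun s' => (∀ i < 18, s'.reg i = s.reg i) ∧ s'.reg 19 = 3 * M + 2 * n + u ∧
    s'.reg 20 = st u ∧ s'.reg 22 = 3 * M + 3 * n + u ∧ s'.out = s.out ∧ s'.mem = s.mem)
    (Reaches.block ⟨?_, ?_, ?_, ?_, ?_, ?_⟩ ?_) ?_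
  · intro i hi
    simp (disch := omega) [execs, exec, Function.update_of_ne]
  · simp [execs, exec, BinOp.eval, hb.r7, h17, e1]
  · simp [execs, exec, BinOp.eval, hb.r7, h17, e1, hmem, layout_st hu]
  · simp [execs, exec, BinOp.eval, hb.r8, h17, e2]
  · simp [execs, exec]
  · simp [execs, exec]
  · simp [execs, exec]
  rintro s₁ ⟨f1, a1, a2, a3, a4, a5⟩
  refine Reaches.seq (Q := fun s' => (∀ i < 18, s'.reg i = s.reg i) ∧
    s'.reg 22 = 3 * M + 3 * n + u ∧ s'.out = s.out ∧
    ∃ st' wh', s'.mem = layout M n x nx wn hd (fun v => (adj M x v).length) st' wh' ∧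
      WedgeLists x tag R wn st' wh' ∧ st' u = tag ∧ IsLinkedList wn (wh' u) l) ?_ ?_
  · by_cases hst : st u = tag
    · refine (Reaches.cond_false (by simp [Test.Holds, a2, f1, h10, hst]) (Reaches.skip
        ⟨f1, a3, a4, st, wh, a5.trans hmem, hwl, hst, ?_⟩)).mono (fun _ h => h) (by norm_num)
      rcases hwl u with h | h
      · exact h.2
      · exact absurd hst h.1.ne
    · have hnil : l = [] := by
        rcases hwl u with h | h
        · exact absurd h.1 hst
        · exact h.2
      refine Reaches.cond_true (B := 3) (by simp [Test.Holds, a2, f1, h10, hst]) (Reaches.block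
        ⟨?_, ?_, ?_, Function.update st u tag, Function.update wh u 0, ?_, ?_, ?_, ?_⟩ ?_)
      · intro i hi
        simp (disch := omega) [execs, exec, f1]
      · simp [execs, exec, a3]
      · simp [execs, exec, a4]
      · simp [execs, exec, a1, a3, a5, f1, h10, hb.r9, hmem, update_layout_st hu, update_layout_wh]
      · intro u'
        by_cases huu : u' = u
        · subst huu
          left
          rw [← hl, hnil]
          simp [IsLinkedList]
        · rw [Function.update_of_ne huu, Function.update_of_ne huu]
          exact hwl u'
      · simp
      · simp [hnil, IsLinkedList]
      · simp [execs, exec]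
  rintro s₂ ⟨f2, b1, b2, st', wh', b3, hwl', b4, b5⟩
  refine Reaches.seq (Q := fun s' => (∀ i < 18, s'.reg i = s.reg i) ∧ s'.reg 18 = wh' u ∧
    s'.out = s.out ∧ s'.mem = layout M n x nx (Function.update wn q (wh' u)) hd
      (fun v => (adj M x v).length) st' wh')
    (Reaches.block ⟨?_, ?_, ?_, ?_⟩ ?_) ?_
  · intro i hi
    simp (disch := omega) [execs, exec, Function.update_of_ne, f2]
  · simp [execs, exec, b1, b3, layout_wh]
  · simp [execs, exec, b2]
  · simp [execs, exec, BinOp.eval, b1, b3, layout_wh, f2, hb.r4, h16, e3, update_layout_wn hq]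
  · simp [execs, exec]
  rintro s₃ ⟨f3, c1, c2, c3⟩
  refine Reaches.seq (reaches_report hW (hb.congr fun i hi => f3 i (by omega)) c3
    (by rw [c1]; exact b5.update hql _) hlM) ?_
  rintro s₄ ⟨f4, d1, d2⟩
  have f4' : ∀ i < 18, s₄.reg i = s.reg i := fun i hi => (f4 i hi).trans (f3 i hi)
  refine Reaches.block ⟨?_, ?_, ?_, ?_, ?_, Function.update wn q (wh' u), st',
    Function.update wh' u (q + 1), ?_, ?_⟩ ?_
  · intro i hi
    simp (disch := omega) [execs, exec, Function.update_of_ne, f4']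
  · refine hb.congr fun i hi => ?_
    simp (disch := omega) [execs, exec, Function.update_of_ne, f4']
  · simp [execs, exec, f4', h10]
  · simp [execs, exec, f4', h11]
  · simp only [execs, exec, d2, c2, ho, wedgePairs, List.flatMap_append, List.append_assoc,
      ← hu', ← hl, List.flatMap_map]
    simp [outWords, f3, h11, h14, h17, ← hu']
  · simp [execs, exec, BinOp.eval, f4', hb.r8, hb.r2, h16, h17, e2, e4, d1, c3, update_layout_wh]
  · intro u'
    by_cases huu : u' = u
    · subst huu
      left
      rw [Function.update_self, List.filter_cons_of_pos (by simp [← hu'])]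
      exact ⟨b4, b5.cons hql⟩
    · rw [Function.update_of_ne huu, List.filter_cons_of_neg (by simpa [← hu'] using Ne.symm huu)]
      rcases hwl' u' with h | h
      · exact Or.inl ⟨h.1, h.2.update (fun hm => hqR (List.mem_filter.1 hm).1) _⟩
      · exact Or.inr h
  · simp [execs, exec]

theorem reaches_treatMiddle (hW : 3 * M + 4 * n + 2 ≤ 2 ^ w) (hx : ∀ j < M, x j < n)
    (hxor : ∀ j < M, j ^^^ 1 < M) (hlist : ∀ v, IsLinkedList nx (hd v) (adj M x v))
    {R : List ℕ} {a : ℕ} {s : State}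
    (h : Treating M n x nx hd o v tag R s) (h13 : s.reg 13 = (adj M x v).length)
    (h14 : s.reg 14 = a) (ha : a < n) (hRa : ∀ r ∈ R, x r ≠ a) (hR : ∀ r ∈ R, r < M) :
    Reaches w treatMiddle s (fun s' => (∀ i < 15, s'.reg i = s.reg i) ∧
      Treating M n x nx hd o v tag
        (((adj M x a).filter (fun q => Before M x (tgt x q) v)).reverse ++ R) s')
      (4 + 31 * (adj M x a).length) := by
  have hb := h.base
  have e1 : (3 * M + a) % 2 ^ w = 3 * M + a := Nat.mod_eq_of_lt (by omega)
  refine Reaches.mono (B := 3 + (1 + ((adj M x a).map fun _ => (31 : ℤ)).sum)) ?_ (fun _ h => h)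
    (by simp; omega)
  refine Reaches.seq (Q := fun s' => (∀ i < 15, s'.reg i = s.reg i) ∧ s'.reg 15 = hd a ∧
    s'.out = s.out ∧ s'.mem = s.mem) (Reaches.block ⟨?_, ?_, ?_, ?_⟩ ?_) ?_
  · intro i hi
    simp (disch := omega) [execs, exec, Function.update_of_ne]
  · obtain ⟨wn, st, wh, hmem, -⟩ := h.mem
    simp [execs, exec, BinOp.eval, hb.r5, h14, e1, hmem, layout_hd ha]
  · simp [execs, exec]
  · simp [execs, exec]
  · simp [execs, exec]
  rintro s₀ ⟨f0, h15, hout0, hmem0⟩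
  refine (Reaches.loop (fun d t s' => (∀ i < 15, s'.reg i = s.reg i) ∧
    IsLinkedList nx (s'.reg 15) t ∧ Treating M n x nx hd o v tag
      ((d.filter (fun q => Before M x (tgt x q) v)).reverse ++ R) s') (fun _ => 31)
      (adj M x a) ?_ ?_ ⟨f0, ?_, ?_⟩).mono (fun s' h => ⟨h.1, h.2.2⟩) le_rfl
  · rintro s' ⟨h1, h2, -⟩
    simp only [IsLinkedList] at h2
    simp [Test.Holds, h2, h1 9, hb.r9]
  · rintro d q t s' hd' ⟨h1, ⟨h2, h3⟩, h4⟩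
    have hb' := h4.base
    have hqa : q ∈ adj M x a := by simp [← hd']
    obtain ⟨hq, hxq⟩ := mem_adj.1 hqa
    have hu : tgt x q < n := hx _ (hxor q hq)
    have hqx := hxor q hq
    have hqd : q ∉ d := fun hqd => by
      have := nodup_adj (M := M) (x := x) a
      rw [← hd', List.nodup_append] at this
      exact this.2.2 q hqd q (by simp) rfl
    have e2 : (q + 1 + (2 ^ w - 1 % 2 ^ w)) % 2 ^ w = q := sub_one_word (by omega)
    have e3 : (q ^^^ 1) % 2 ^ w = q ^^^ 1 := Nat.mod_eq_of_lt (by omega)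
    have e4 : (M + q) % 2 ^ w = M + q := Nat.mod_eq_of_lt (by omega)
    have e5 : (3 * M + n + tgt x q) % 2 ^ w = 3 * M + n + tgt x q := Nat.mod_eq_of_lt (by omega)
    refine ⟨by simp [Test.Holds, h2, h1 9, hb.r9], ?_⟩
    refine Reaches.mono (B := 8 + (4 + (1 + 17))) ?_ (fun _ h => h) (by norm_num)
    refine Reaches.seq (Q := fun s₁ => (∀ i < 15, s₁.reg i = s.reg i) ∧ s₁.reg 16 = q ∧
      s₁.reg 17 = tgt x q ∧ s₁.reg 20 = (adj M x (tgt x q)).length ∧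
      IsLinkedList nx (s₁.reg 15) t ∧ Treating M n x nx hd o v tag
        ((d.filter (fun q => Before M x (tgt x q) v)).reverse ++ R) s₁) ?_ ?_
    · obtain ⟨wn, st, wh, hmem, -⟩ := h4.mem
      refine Reaches.block ⟨?_, ?_, ?_, ?_, ?_, h4.congr ?_ ?_ ?_⟩ ?_
      · intro i hi
        simp (disch := omega) [execs, exec, Function.update_of_ne, h1]
      · simp [execs, exec, BinOp.eval, h2, hb'.r2, e2]
      · simp [execs, exec, BinOp.eval, h2, hb'.r2, e2, e3, hmem, layout_x hqx, tgt]
      · have e5' := e5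
        rw [tgt] at e5'
        simp [execs, exec, BinOp.eval, h2, hb'.r2, e2, e3, hmem, layout_x hqx, hb'.r6, e5',
          layout_dg (hx _ hqx), tgt]
      · simpa [execs, exec, BinOp.eval, h2, hb'.r2, hb'.r3, e2, e4, hmem, layout_nx hq] using h3
      · intro i hi
        simp (disch := omega) [execs, exec, Function.update_of_ne]
      · simp [execs, exec]
      · simp [execs, exec]
      · simp [execs, exec]
    rintro s₁ ⟨f1, a1, a2, a3, a4, a5⟩
    refine Reaches.seq (reaches_compare (M := M) (x := x) (by omega) ?_ ?_) ?_
    · rw [f1 13 (by norm_num), h13, a5.r11]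
    · rw [a3, a2]
    rintro s₂ rfl
    rw [a2, a5.r11]
    set s₂ : State := { s₁ with
      reg := Function.update s₁.reg 21 (if Before M x (tgt x q) v then 1 else 0) } with hs₂
    have f2 : ∀ i < 21, s₂.reg i = s₁.reg i := fun i hi => Function.update_of_ne (by omega) _ _
    have b1 : s₂.reg 21 = if Before M x (tgt x q) v then 1 else 0 := by simp [hs₂]
    have a5' : Treating M n x nx hd o v tag
        ((d.filter (fun q => Before M x (tgt x q) v)).reverse ++ R) s₂ :=
      a5.congr (fun i hi => f2 i (by omega)) rfl rfl
    by_cases hB : Before M x (tgt x q) v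
    · rw [if_pos hB] at b1
      refine Reaches.cond_true (by simp [Test.Holds, b1, a5'.base.r2]) ?_
      refine (reaches_treatWedge hW a5' (q := q) ?_ ?_ ?_ hq hu ?_ ?_).mono ?_ le_rfl
      · rw [f2 14 (by norm_num), f1 14 (by norm_num), h14, hxq]
      · rw [f2 16 (by norm_num), a1]
      · rw [f2 17 (by norm_num), a2]
      · simp only [List.mem_append, List.mem_reverse, List.mem_filter, not_or]
        exact ⟨fun h => hqd h.1, fun h => hRa q h hxq⟩
      · intro r hr
        simp only [List.mem_append, List.mem_reverse, List.mem_filter] at hr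
        rcases hr with hr | hr
        · exact (mem_adj.1 (show r ∈ adj M x a by rw [← hd']; simp [hr.1])).1
        · exact hR r hr
      · rintro s₃ ⟨f3, c1⟩
        refine ⟨fun i hi => ?_, ?_, ?_⟩
        · rw [f3 i (by omega), f2 i (by omega), f1 i hi]
        · rwa [f3 15 (by norm_num), f2 15 (by norm_num)]
        · simpa [List.filter_append, hB] using c1
    · rw [if_neg hB] at b1
      refine (Reaches.cond_false (by simp [Test.Holds, b1, a5'.base.r2]) (Reaches.skip ?_)).mono
        (fun _ h => h) (show (1 + 1 : ℤ) ≤ 1 + 17 by norm_num)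
      refine ⟨fun i hi => ?_, ?_, ?_⟩
      · rw [f2 i (by omega), f1 i hi]
      · rwa [f2 15 (by norm_num)]
      · simpa [List.filter_append, hB] using a5'
  · rw [h15]
    exact hlist a
  · exact h.congr (fun i hi => f0 i (by omega)) hout0 hmem0

theorem reaches_treatVertex (hW : 3 * M + 4 * n + 2 ≤ 2 ^ w) (hx : ∀ j < M, x j < n)
    (hxor : ∀ j < M, j ^^^ 1 < M) (hlist : ∀ v, IsLinkedList nx (hd v) (adj M x v))
    (hinj : ∀ p < M, ∀ q < M, x p = x q → tgt x p = tgt x q → p = q) {s : State}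
    (h : Treating M n x nx hd o v tag [] s) (hv : v < n)
    (h12 : s.reg 12 = hd v) :
    Reaches w treatVertex s (fun s' => Treating M n x nx hd o v tag
        (wedges M x v (adj M x v)).reverse s')
      (4 + ((adj M x v).map (edgeCost M x v)).sum) := by
  have hb := h.base
  have e1 : (3 * M + n + v) % 2 ^ w = 3 * M + n + v := Nat.mod_eq_of_lt (by omega)
  refine Reaches.mono (B := 3 + (1 + ((adj M x v).map (edgeCost M x v)).sum)) ?_ (fun _ h => h)
    (by omega)
  refine Reaches.seq (Q := fun s' => (∀ i < 13, s'.reg i = s.reg i) ∧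
    s'.reg 13 = (adj M x v).length ∧
    s'.out = s.out ∧ s'.mem = s.mem) (Reaches.block ⟨?_, ?_, ?_, ?_⟩ ?_) ?_
  · intro i hi
    simp (disch := omega) [execs, exec, Function.update_of_ne]
  · obtain ⟨wn, st, wh, hmem, -⟩ := h.mem
    simp [execs, exec, BinOp.eval, hb.r6, h.r11, e1, hmem, layout_dg hv]
  · simp [execs, exec]
  · simp [execs, exec]
  · simp [execs, exec]
  rintro s₀ ⟨f0, h13, hout0, hmem0⟩
  refine (Reaches.loop (fun d t s' => s'.reg 13 = (adj M x v).length ∧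
    IsLinkedList nx (s'.reg 12) t ∧ Treating M n x nx hd o v tag (wedges M x v d).reverse s')
      (edgeCost M x v) (adj M x v) ?_ ?_ ⟨h13, ?_, ?_⟩).mono (fun s' h => h.2.2) le_rfl
  · rintro s' ⟨-, h2, h3⟩
    simp only [IsLinkedList] at h2
    simp [Test.Holds, h2, h3.base.r9]
  · rintro d p t s' hd' ⟨h1, ⟨h2, h3⟩, h4⟩
    have hb' := h4.base
    have hdv : ∀ q ∈ d, q ∈ adj M x v := fun q hq => by rw [← hd']; simp [hq]
    obtain ⟨hp, hxp⟩ := mem_adj.1 (show p ∈ adj M x v by simp [← hd'])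
    have ha : tgt x p < n := hx _ (hxor p hp)
    have hpx := hxor p hp
    have hpd : p ∉ d := fun hqd => by
      have := nodup_adj (M := M) (x := x) v
      rw [← hd', List.nodup_append] at this
      exact this.2.2 p hqd p (by simp) rfl
    have e2 : (p + 1 + (2 ^ w - 1 % 2 ^ w)) % 2 ^ w = p := sub_one_word (by omega)
    have e3 : (p ^^^ 1) % 2 ^ w = p ^^^ 1 := Nat.mod_eq_of_lt (by omega)
    have e4 : (M + p) % 2 ^ w = M + p := Nat.mod_eq_of_lt (by omega)
    have e5 : (3 * M + n + tgt x p) % 2 ^ w = 3 * M + n + tgt x p := Nat.mod_eq_of_lt (by omega)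
    refine ⟨by simp [Test.Holds, h2, hb'.r9], ?_⟩
    refine Reaches.mono (B := 8 + (4 + (1 + (edgeCost M x v p - 14)))) ?_ (fun _ h => h)
      (by omega)
    refine Reaches.seq (Q := fun s₁ => s₁.reg 13 = (adj M x v).length ∧
      s₁.reg 14 = tgt x p ∧ s₁.reg 20 = (adj M x (tgt x p)).length ∧
      IsLinkedList nx (s₁.reg 12) t ∧ Treating M n x nx hd o v tag (wedges M x v d).reverse s₁)
      ?_ ?_
    · obtain ⟨wn, st, wh, hmem, -⟩ := h4.mem
      have hbase : BaseRegs M n (execs w [op .sub 16 12 2, op .xor 19 16 2, load 14 19,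
          op .add 19 3 16, load 12 19, op .add 19 6 14, load 20 19] s').reg := by
        refine hb'.congr fun i hi => ?_
        simp (disch := omega) [execs, exec, Function.update_of_ne]
      refine Reaches.block ⟨?_, ?_, ?_, ?_, hbase, ?_, ?_, ?_, ?_⟩ ?_
      · simp [execs, exec, h1]
      · simp [execs, exec, BinOp.eval, h2, hb'.r2, e2, e3, hmem, layout_x hpx, tgt]
      · have e5' := e5
        rw [tgt] at e5'
        simp [execs, exec, BinOp.eval, h2, hb'.r2, e2, e3, hmem, layout_x hpx, hb'.r6, e5',
          layout_dg (hx _ hpx), tgt]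
      · simpa [execs, exec, BinOp.eval, h2, hb'.r2, hb'.r3, e2, e4, hmem, layout_nx hp] using h3
      · simp [execs, exec, h4.r10]
      · simp [execs, exec, h4.r11]
      · simp [execs, exec, h4.out]
      · simpa [execs, exec] using h4.mem
      · simp [execs, exec]
    rintro s₁ ⟨a1, a2, a3, a4, a5⟩
    refine Reaches.seq (reaches_compare (M := M) (x := x) (by omega) ?_ ?_) ?_
    · rw [a1, a5.r11]
    · rw [a3, a2]
    rintro s₂ rfl
    rw [a2, a5.r11]
    set s₂ : State := { s₁ with
      reg := Function.update s₁.reg 21 (if Before M x (tgt x p) v then 1 else 0) } with hs₂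
    have f2 : ∀ i < 21, s₂.reg i = s₁.reg i := fun i hi => Function.update_of_ne (by omega) _ _
    have b1 : s₂.reg 21 = if Before M x (tgt x p) v then 1 else 0 := by simp [hs₂]
    have a5' : Treating M n x nx hd o v tag (wedges M x v d).reverse s₂ :=
      a5.congr (fun i hi => f2 i (by omega)) rfl rfl
    have happ : wedges M x v (d ++ [p]) = wedges M x v d ++ wedgesVia M x v p := by
      simp [wedges]
    by_cases hB : Before M x (tgt x p) v
    · rw [if_pos hB] at b1
      refine Reaches.cond_true (by simp [Test.Holds, b1, a5'.base.r2]) ?_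
      -- the middle vertex is a new one, as no two half-edges have the same endpoints
      refine (reaches_treatMiddle hW hx hxor hlist a5' (a := tgt x p) ?_ ?_ ha ?_ ?_).mono ?_ ?_
      · rw [f2 13 (by norm_num), a1]
      · rw [f2 14 (by norm_num), a2]
      · intro r hr hra
        obtain ⟨p', hp', -, -, hr', -⟩ := mem_wedges.1 (List.mem_reverse.1 hr)
        obtain ⟨hp'M, hxp'⟩ := mem_adj.1 (hdv p' hp')
        have : p' = p := hinj p' hp'M p hp (hxp'.trans hxp.symm) (hr'.symm.trans hra)
        exact hpd (this ▸ hp')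
      · intro r hr
        obtain ⟨p', -, -, hr', -⟩ := mem_wedges.1 (List.mem_reverse.1 hr)
        exact hr'
      · rintro s₃ ⟨f3, c1⟩
        refine ⟨?_, ?_, ?_⟩
        · rw [f3 13 (by norm_num), f2 13 (by norm_num), a1]
        · rwa [f3 12 (by norm_num), f2 12 (by norm_num)]
        · rw [happ, List.reverse_append, wedgesVia, if_pos hB]
          exact c1
      · rw [edgeCost, if_pos hB]
        omega
    · rw [if_neg hB] at b1
      refine (Reaches.cond_false (by simp [Test.Holds, b1, a5'.base.r2]) (Reaches.skip ?_)).mono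
        (fun _ h => h) (by rw [edgeCost, if_neg hB]; norm_num)
      refine ⟨?_, ?_, ?_⟩
      · rw [f2 13 (by norm_num), a1]
      · rwa [f2 12 (by norm_num)]
      · rw [happ, wedgesVia, if_neg hB, List.append_nil]
        exact a5'
  · rw [f0 12 (by norm_num), h12]
    exact hlist v
  · exact h.congr (fun i hi => f0 i (by omega)) hout0 hmem0

/-- The output of the program, and its running time up to the cost of the output. -/
theorem reaches_listFourCycles (hW : 3 * M + 4 * n + 2 ≤ 2 ^ w) (hx : ∀ j < M, x j < n)
    (hxor : ∀ j < M, j ^^^ 1 < M)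
    (hinj : ∀ p < M, ∀ q < M, x p = x q → tgt x p = tgt x q → p = q) {s : State}
    (h0 : s.reg 0 = n) (h1 : 2 * s.reg 1 = M) (hr : ∀ i, 2 ≤ i → s.reg i = 0)
    (hmem : s.mem = layout M n x 0 0 0 0 0 0) (hout : s.out = []) :
    Reaches w listFourCycles s (fun s' => s'.out = (List.range M).flatMap (outAt M x))
      (12 + 13 * M + ((List.range M).map (costAt M x)).sum) := by
  refine Reaches.mono (B := 8 + ((1 + 13 * M) + (2 + (1 + ((List.range M).map (costAt M x)).sum))))
    ?_ (fun _ h => h) (by omega)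
  refine Reaches.seq (Q := fun s' => BaseRegs M n s'.reg ∧ s'.reg 10 = 0 ∧ s'.mem = s.mem ∧
    s'.out = s.out) ?_ ?_
  · have e1 : (s.reg 1 + s.reg 1) % 2 ^ w = M := by
      rw [← two_mul, h1]; exact Nat.mod_eq_of_lt (by omega)
    have e2 : (M + M) % 2 ^ w = 2 * M := by
      rw [← two_mul]; exact Nat.mod_eq_of_lt (by omega)
    have e3 : (2 * M + M) % 2 ^ w = 3 * M := by
      rw [← Nat.succ_mul]; exact Nat.mod_eq_of_lt (by omega)
    have e4 : (3 * M + n) % 2 ^ w = 3 * M + n := Nat.mod_eq_of_lt (by omega)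
    have e5 : (3 * M + n + n) % 2 ^ w = 3 * M + 2 * n := by
      rw [add_assoc, ← two_mul]; exact Nat.mod_eq_of_lt (by omega)
    have e6 : (3 * M + 2 * n + n) % 2 ^ w = 3 * M + 3 * n := by
      rw [add_assoc, ← Nat.succ_mul]; exact Nat.mod_eq_of_lt (by omega)
    have e7 : 1 % 2 ^ w = 1 := Nat.mod_eq_of_lt (by omega)
    refine Reaches.block ⟨⟨?_, ?_, ?_, ?_, ?_, ?_, ?_, ?_, ?_⟩, ?_, ?_, ?_⟩ ?_ <;>
      simp [execs, exec, BinOp.eval, h0, hr, e1, e2, e3, e4, e5, e6, e7]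
  rintro s₁ ⟨a1, a2, a3, a4⟩
  refine Reaches.seq (reaches_build hW hx a1 a2 (a3.trans hmem)) ?_
  rintro s₂ ⟨b1, b2, nx, hd, b3, hlist⟩
  refine Reaches.seq (Q := fun s' => BaseRegs M n s'.reg ∧ s'.reg 10 = 0 ∧ s'.mem = s₂.mem ∧
    s'.out = []) (Reaches.block ⟨?_, ?_, ?_, ?_⟩ ?_) ?_
  · refine b1.congr fun i hi => ?_
    simp (disch := omega) [execs, exec, Function.update_of_ne]
  · simp [execs, exec]
  · simp [execs, exec]
  · simp [execs, exec, b2, a4, hout]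
  · simp [execs, exec]
  rintro s₃ ⟨c1, c2, c3, c4⟩
  refine (Reaches.loop (fun d (_ : List ℕ) s' => BaseRegs M n s'.reg ∧ s'.reg 10 = d.length ∧
    s'.out = (List.range d.length).flatMap (outAt M x) ∧ ∃ wn st wh,
      s'.mem = layout M n x nx wn hd (fun v => (adj M x v).length) st wh ∧
      ∀ u, st u ≤ d.length) (costAt M x) (List.range M) ?_ ?_
      ⟨c1, c2, by simp [c4], 0, 0, 0, by rw [c3, b3], by simp⟩).mono ?_ le_rfl
  · rintro s' ⟨d1, d2, -⟩
    simp [Test.Holds, d1.r3, d2]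
  · rintro d j t s' hd' ⟨d1, d2, d3, wn, st, wh, d4, d5⟩
    have hlt : d.length < M := by
      have := congrArg List.length hd'
      simp at this
      omega
    have hj : j = d.length := by
      have := congrArg (fun l => l[d.length]?) hd'
      simpa [hlt] using this
    subst hj
    simp only [List.length_append, List.length_singleton]
    generalize d.length = j at *
    set v := x j with hv
    have hvn : v < n := hx j hlt
    have e1 : (3 * M + v) % 2 ^ w = 3 * M + v := Nat.mod_eq_of_lt (by omega)
    have e2 : (j + 1) % 2 ^ w = j + 1 := Nat.mod_eq_of_lt (by omega)
    -- the head pointer identifies the half-edge at which the vertex is treated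
    have hhead : hd v = j + 1 ↔ (adj M x v).head? = some j := by
      have hl := hlist v
      cases hadj : adj M x v with
      | nil => rw [hadj] at hl; simp [show hd v = 0 from hl]
      | cons k l => rw [hadj] at hl; simp [show hd v = k + 1 from hl.1]
    refine ⟨by simp [Test.Holds, d1.r3, d2, hlt], ?_⟩
    refine Reaches.mono (B := 5 + (1 + (costAt M x j - 7))) ?_ (fun _ h => h) (by omega)
    refine Reaches.seq (Q := fun s₄ => Treating M n x nx hd
      ((List.range j).flatMap (outAt M x)) v (j + 1) [] s₄ ∧ s₄.reg 12 = hd v)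
      (Reaches.block ⟨⟨?_, ?_, ?_, ?_, wn, st, wh, ?_, ?_⟩, ?_⟩ ?_) ?_
    · refine d1.congr fun i hi => ?_
      simp (disch := omega) [execs, exec, Function.update_of_ne]
    · simp [execs, exec, BinOp.eval, d2, d1.r2, e2]
    · simp [execs, exec, d2, d4, layout_x hlt, hv]
    · simp [execs, exec, d3, wedgePairs]
    · simp [execs, exec, d4]
    · intro u
      exact Or.inr ⟨Nat.lt_succ_of_le (d5 u), rfl⟩
    · simp [execs, exec, BinOp.eval, d2, d4, layout_x hlt, ← hv, d1.r5, e1, layout_hd hvn]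
    · simp [execs, exec]
    rintro s₄ ⟨g1, g2⟩
    have hrange : (List.range (j + 1)).flatMap (outAt M x) =
        (List.range j).flatMap (outAt M x) ++ outAt M x j := by
      simp [List.range_succ]
    by_cases hh : (adj M x v).head? = some j
    · refine Reaches.cond_true (by simp [Test.Holds, g1.r10, g2, hhead.2 hh]) ?_
      refine (reaches_treatVertex hW hx hxor hlist hinj g1 hvn g2).mono ?_ ?_
      · rintro s₅ ⟨k1, k2, k3, k4, wn', st', wh', k5, k6⟩
        refine ⟨k1, k2, ?_, wn', st', wh', k5, fun u => ?_⟩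
        · rw [k4, hrange, outAt, ← hv, if_pos hh, pairsAt]
        · rcases k6 u with h | h
          · exact h.1.le
          · exact h.1.le
      · rw [costAt, ← hv, if_pos hh]
        omega
    · refine (Reaches.cond_false (by simp [Test.Holds, g1.r10, g2, hhead, hh])
        (Reaches.skip ?_)).mono (fun _ h => h) (by rw [costAt, ← hv, if_neg hh]; norm_num)
      obtain ⟨k1, k2, k3, k4, wn', st', wh', k5, k6⟩ := g1
      refine ⟨k1, k2, ?_, wn', st', wh', k5, fun u => ?_⟩
      · rw [k4, hrange, outAt, ← hv, if_neg hh]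
        simp [wedgePairs]
      · rcases k6 u with h | h
        · exact h.1.le
        · exact h.1.le
  · rintro s' ⟨-, -, d3, -⟩
    simpa using d3

end Verification

/-! ### Every 4-cycle is written exactly once -/

/-- The first `M` cells of `x` hold the half-edges of the graph `G`, the two halves of an edge in
the cells `2 i` and `2 i + 1`. -/
structure IsHalfEdges {n : ℕ} (G : SimpleGraph (Fin n)) (M : ℕ) (x : ℕ → ℕ) : Prop where
  lt : ∀ j < M, x j < n
  xor_lt : ∀ j < M, j ^^^ 1 < M
  inj : ∀ p < M, ∀ q < M, x p = x q → tgt x p = tgt x q → p = q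
  adj_iff : ∀ a b : Fin n, G.Adj a b ↔ ∃ j < M, x j = a ∧ tgt x j = b

section Pairs

variable {x : ℕ → ℕ}

theorem of_mem_wedgePairs {l : List ℕ} {q r : ℕ} (h : (q, r) ∈ wedgePairs x l) :
    q ∈ l ∧ r ∈ l ∧ tgt x r = tgt x q := by
  induction l with
  | nil => simp [wedgePairs] at h
  | cons a l ih =>
    simp only [wedgePairs, List.mem_append, List.mem_map, List.mem_filter, decide_eq_true_eq,
      Prod.mk.injEq] at h
    rcases h with h | ⟨r', ⟨h1, h2⟩, rfl, rfl⟩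
    · have := ih h
      simp [this]
    · simp [h1, h2]

theorem swap_notMem_wedgePairs {l : List ℕ} (hl : l.Nodup) {q r : ℕ}
    (h : (q, r) ∈ wedgePairs x l) : (r, q) ∉ wedgePairs x l := by
  induction l with
  | nil => simp [wedgePairs]
  | cons a l ih =>
    intro h'
    obtain ⟨hal, hl⟩ := List.nodup_cons.1 hl
    simp only [wedgePairs, List.mem_append, List.mem_map, List.mem_filter, decide_eq_true_eq,
      Prod.mk.injEq] at h h'
    rcases h with h | ⟨r', ⟨h1, h2⟩, rfl, rfl⟩ <;> rcases h' with h' | ⟨r'', ⟨h3, h4⟩, h5, rfl⟩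
    · exact ih hl h h'
    · exact hal (h5 ▸ (of_mem_wedgePairs h).2.1)
    · exact hal (of_mem_wedgePairs h').2.1
    · exact hal (h5 ▸ h1)

theorem nodup_wedgePairs {l : List ℕ} (hl : l.Nodup) : (wedgePairs x l).Nodup := by
  induction l with
  | nil => simp [wedgePairs]
  | cons a l ih =>
    obtain ⟨hal, hl⟩ := List.nodup_cons.1 hl
    rw [wedgePairs]
    refine (ih hl).append ((hl.filter _).map fun r r' h => (Prod.mk.inj h).2) ?_
    rintro ⟨q, r⟩ h h'
    obtain ⟨r', -, h3⟩ := List.mem_map.1 h'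
    obtain ⟨rfl, rfl⟩ := Prod.mk.inj h3
    exact hal (of_mem_wedgePairs h).1

theorem mem_wedgePairs_or {l : List ℕ} {q r : ℕ} (hq : q ∈ l) (hr : r ∈ l) (hqr : q ≠ r)
    (h : tgt x q = tgt x r) : (q, r) ∈ wedgePairs x l ∨ (r, q) ∈ wedgePairs x l := by
  induction l with
  | nil => simp at hq
  | cons a l ih =>
    simp only [wedgePairs, List.mem_append, List.mem_map, List.mem_filter, decide_eq_true_eq,
      Prod.mk.injEq]
    rcases List.mem_cons.1 hq with rfl | hq' <;> rcases List.mem_cons.1 hr with rfl | hr'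
    · exact absurd rfl hqr
    · exact Or.inl (Or.inr ⟨r, ⟨hr', h.symm⟩, rfl, rfl⟩)
    · exact Or.inr (Or.inr ⟨q, ⟨hq', h⟩, rfl, rfl⟩)
    · exact (ih hq' hr').imp Or.inl Or.inl

end Pairs

section Order

variable (M : ℕ) (x : ℕ → ℕ)

/-- The sort key of the order `Before`. -/
def sortKey (a : ℕ) : ℕ ×ₗ ℕ := toLex ((adj M x a).length, a)

variable {M x}

theorem before_iff {a v : ℕ} : Before M x a v ↔ sortKey M x a < sortKey M x v := by
  simp [Before, sortKey, Prod.Lex.toLex_lt_toLex]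

theorem sortKey_injective : Function.Injective (sortKey M x) := fun a b h => by
  simpa [sortKey] using congrArg (fun p => (ofLex p).2) h

theorem before_asymm {a v : ℕ} (h : Before M x a v) : ¬ Before M x v a := by
  rw [before_iff] at *
  exact h.asymm

theorem before_irrefl (a : ℕ) : ¬ Before M x a a := fun h => before_asymm h h

end Order

section Cycles

variable {V : Type*} {G : SimpleGraph V}

theorem isFourCycle_rotate {a b c d : V} (h : IsFourCycle G (a, b, c, d)) :
    IsFourCycle G (b, c, d, a) := by
  obtain ⟨h1, h2, h3, h4, h5⟩ := h
  refine ⟨h2, h3, h4, h1, ?_⟩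
  simp only [List.nodup_cons, List.mem_cons, List.not_mem_nil, or_false, not_or] at h5 ⊢
  tauto

theorem cycleEdges_rotate (a b c d : V) : cycleEdges (b, c, d, a) = cycleEdges (a, b, c, d) := by
  ext e
  simp only [cycleEdges, Set.mem_insert_iff, Set.mem_singleton_iff]
  tauto

theorem cycleEdges_reverse (v a u b : V) : cycleEdges (v, b, u, a) = cycleEdges (v, a, u, b) := by
  ext e
  simp only [cycleEdges, Set.mem_insert_iff, Set.mem_singleton_iff, Sym2.eq_swap (a := v) (b := b),
    Sym2.eq_swap (a := b) (b := u), Sym2.eq_swap (a := u) (b := a), Sym2.eq_swap (a := a) (b := v)]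
  tauto

/-- The edge set of a 4-cycle determines its greatest vertex, the vertex opposite to it, and
the other two up to their order. -/
theorem eq_of_cycleEdges_eq {R : V → V → Prop} (hR : ∀ a b, R a b → ¬ R b a)
    {v a u b v' a' u' b' : V} (h : IsFourCycle G (v, a, u, b)) (h' : IsFourCycle G (v', a', u', b'))
    (hav : R a v) (huv : R u v) (hbv : R b v) (hav' : R a' v') (huv' : R u' v') (hbv' : R b' v')
    (hE : cycleEdges (v, a, u, b) = cycleEdges (v', a', u', b')) :
    v = v' ∧ u = u' ∧ (a = a' ∧ b = b' ∨ a = b' ∧ b = a') := by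
  have hv : v = v' ∨ R v v' := by
    have hm : s(v, a) ∈ cycleEdges (v', a', u', b') := by rw [← hE]; simp [cycleEdges]
    rcases eq_or_of_mem_cycleEdges hm with rfl | rfl | rfl | rfl <;> simp [*]
  have hv' : v' = v ∨ R v' v := by
    have hm : s(v', a') ∈ cycleEdges (v, a, u, b) := by rw [hE]; simp [cycleEdges]
    rcases eq_or_of_mem_cycleEdges hm with rfl | rfl | rfl | rfl <;> simp [*]
  have hvv : v = v' := by
    rcases hv with rfl | hv
    · rfl
    rcases hv' with rfl | hv'
    · rfl
    exact absurd hv' (hR _ _ hv)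
  subst hvv
  obtain ⟨-, -, -, -, h5⟩ := h
  obtain ⟨-, -, -, -, h5'⟩ := h'
  simp only [List.nodup_cons, List.mem_cons, List.not_mem_nil, or_false, not_or] at h5 h5'
  obtain ⟨⟨n1, n2, n3⟩, ⟨n4, n5⟩, n6, -⟩ := h5
  obtain ⟨⟨m1, m2, m3⟩, ⟨m4, m5⟩, m6, -⟩ := h5'
  have ha : s(v, a') ∈ cycleEdges (v, a, u, b) := by rw [hE]; simp [cycleEdges]
  have hb : s(v, b') ∈ cycleEdges (v, a, u, b) := by
    rw [hE, Sym2.eq_swap]; simp [cycleEdges]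
  have hu : s(a', u') ∈ cycleEdges (v, a, u, b) := by rw [hE]; simp [cycleEdges]
  simp only [cycleEdges, Set.mem_insert_iff, Set.mem_singleton_iff, Sym2.eq_iff] at ha hb hu
  have ha' : a' = a ∨ a' = b := by
    simpa only [n1, n2, n3, true_and, false_and, or_false, false_or] using ha
  have hb' : b' = a ∨ b' = b := by
    simpa only [n1, n2, n3, true_and, false_and, or_false, false_or] using hb
  clear ha hb hE hv hv'
  have hu' : u' = u := by
    rcases ha' with rfl | rfl <;>
      rcases hu with (⟨h1, h2⟩ | ⟨h1, h2⟩) | (⟨h1, h2⟩ | ⟨h1, h2⟩) | (⟨h1, h2⟩ | ⟨h1, h2⟩) |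
        (⟨h1, h2⟩ | ⟨h1, h2⟩) <;> simp_all
  refine ⟨rfl, hu'.symm, ?_⟩
  rcases ha' with rfl | rfl <;> rcases hb' with rfl | rfl <;> simp_all

end Cycles

section Output

variable {n M : ℕ} {G : SimpleGraph (Fin n)} {x : ℕ → ℕ}

theorem IsHalfEdges.nodup_wedges (H : IsHalfEdges G M x) (v : ℕ) :
    (wedges M x v (adj M x v)).Nodup := by
  rw [wedges, List.nodup_flatMap]
  constructor
  · intro p _
    rw [wedgesVia]
    split_ifs
    · exact (nodup_adj _).filter _
    · exact List.nodup_nil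
  · refine (nodup_adj v).imp_of_mem fun {p p'} hp hp' hne => ?_
    intro q hq hq'
    have h1 : q ∈ wedges M x v [p] := by simpa [wedges] using hq
    have h2 : q ∈ wedges M x v [p'] := by simpa [wedges] using hq'
    simp only [mem_wedges, List.mem_singleton, exists_eq_left] at h1 h2
    obtain ⟨hpM, hpv⟩ := mem_adj.1 hp
    obtain ⟨hpM', hpv'⟩ := mem_adj.1 hp'
    exact hne (H.inj p hpM p' hpM' (hpv.trans hpv'.symm) (h1.2.2.1.symm.trans h2.2.2.1))

variable (M x) in
/-- The pairs of wedges in the order in which they are found, each with its first vertex. -/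
def triples : List (ℕ × ℕ × ℕ) :=
  (List.range M).flatMap fun j =>
    if (adj M x (x j)).head? = some j then (pairsAt M x (x j)).map (fun p => (x j, p)) else []

theorem flatMap_outAt : (List.range M).flatMap (outAt M x) =
    (triples M x).flatMap (fun y => outWords x y.1 y.2) := by
  rw [triples, List.flatMap_assoc]
  congr 1
  funext j
  rw [outAt]
  split_ifs
  · rw [List.flatMap_map]
  · rfl

theorem mem_triples {v q r : ℕ} : (v, q, r) ∈ triples M x ↔ (q, r) ∈ pairsAt M x v := by
  simp only [triples, List.mem_flatMap, List.mem_range]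
  constructor
  · rintro ⟨j, -, h⟩
    split_ifs at h
    · obtain ⟨p, hp, hpe⟩ := List.mem_map.1 h
      obtain ⟨rfl, rfl⟩ := Prod.mk.inj hpe
      exact hp
    · simp at h
  · intro h
    cases hadj : adj M x v with
    | nil => simp [pairsAt, hadj, wedges, wedgePairs] at h
    | cons j l =>
      obtain ⟨hj, rfl⟩ := mem_adj.1 (show j ∈ adj M x v by simp [hadj])
      exact ⟨j, hj, by rw [hadj]; simpa using h⟩

theorem IsHalfEdges.nodup_triples (H : IsHalfEdges G M x) : (triples M x).Nodup := by
  rw [triples, List.nodup_flatMap]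
  constructor
  · intro j _
    split_ifs
    · exact (nodup_wedgePairs (List.nodup_reverse.2 (H.nodup_wedges _))).map
        fun p p' h => (Prod.mk.inj h).2
    · exact List.nodup_nil
  · refine List.nodup_range.imp fun {j j'} hne => ?_
    intro y hy hy'
    dsimp only at hy hy'
    split_ifs at hy hy' with h1 h2
    · obtain ⟨p, -, rfl⟩ := List.mem_map.1 hy
      obtain ⟨p', -, hp'⟩ := List.mem_map.1 hy'
      have hxx : x j' = x j := (Prod.mk.inj hp').1
      rw [hxx, h1] at h2
      exact hne (Option.some.inj h2)
    all_goals simp at hy hy'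

theorem IsHalfEdges.tgt_lt (H : IsHalfEdges G M x) {j : ℕ} (hj : j < M) : tgt x j < n :=
  H.lt _ (H.xor_lt j hj)

/-- What is written for a pair of wedges is a 4-cycle, and its first vertex is the greatest. -/
theorem IsHalfEdges.of_mem_pairsAt (H : IsHalfEdges G M x) {v q r : ℕ}
    (h : (q, r) ∈ pairsAt M x v) :
    ∃ (hv : v < n) (hq : q < M) (hr : r < M), tgt x r = tgt x q ∧
      Before M x (x q) v ∧ Before M x (tgt x q) v ∧ Before M x (x r) v ∧
      IsFourCycle G (⟨v, hv⟩, ⟨x q, H.lt q hq⟩, ⟨tgt x q, H.tgt_lt hq⟩, ⟨x r, H.lt r hr⟩) := by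
  have hnd := List.nodup_reverse.2 (H.nodup_wedges v)
  obtain ⟨hqm, hrm, ht⟩ := of_mem_wedgePairs h
  have hne : q ≠ r := fun hqr => by
    subst hqr
    exact swap_notMem_wedgePairs hnd h h
  obtain ⟨p, hp, b1, hq, hqp, b2⟩ := mem_wedges.1 (List.mem_reverse.1 hqm)
  obtain ⟨p', hp', b3, hr, hrp, -⟩ := mem_wedges.1 (List.mem_reverse.1 hrm)
  obtain ⟨hpM, rfl⟩ := mem_adj.1 hp
  obtain ⟨hpM', hpv'⟩ := mem_adj.1 hp'
  rw [← hqp] at b1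
  rw [← hrp] at b3
  refine ⟨H.lt p hpM, hq, hr, ht, b1, b2, b3, ?_⟩
  have a1 : G.Adj ⟨x p, H.lt p hpM⟩ ⟨x q, H.lt q hq⟩ := (H.adj_iff _ _).2 ⟨p, hpM, rfl, hqp.symm⟩
  have a2 : G.Adj ⟨x q, H.lt q hq⟩ ⟨tgt x q, H.tgt_lt hq⟩ := (H.adj_iff _ _).2 ⟨q, hq, rfl, rfl⟩
  have a3 : G.Adj ⟨x r, H.lt r hr⟩ ⟨tgt x q, H.tgt_lt hq⟩ := (H.adj_iff _ _).2 ⟨r, hr, rfl, ht⟩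
  have a4 : G.Adj ⟨x p, H.lt p hpM⟩ ⟨x r, H.lt r hr⟩ :=
    (H.adj_iff _ _).2 ⟨p', hpM', hpv', hrp.symm⟩
  refine ⟨a1, a2, a3.symm, a4.symm, ?_⟩
  have n1 : x p ≠ tgt x q := fun hh => before_irrefl (M := M) (x := x) (x p) (by rwa [← hh] at b2)
  have n2 : x q ≠ x r := fun hh => hne (H.inj q hq r hr hh ht.symm)
  have n3 := a1.ne
  have n4 := a2.ne
  have n5 := a3.ne'
  have n6 := a4.ne
  simp only [ne_eq, Fin.mk.injEq] at n3 n4 n5 n6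
  simp [n1, n2, n3, n4, n5, n6]

/-- Every 4-cycle can be written so that its first vertex is the greatest. -/
theorem exists_rotation_before {S : Set (Sym2 (Fin n))} (hS : S ∈ fourCycles G) :
    ∃ v a u b : Fin n, IsFourCycle G (v, a, u, b) ∧ S = cycleEdges (v, a, u, b) ∧
      Before M x a v ∧ Before M x u v ∧ Before M x b v := by
  obtain ⟨⟨a, b, c, d⟩, h, rfl⟩ := hS
  have hmax : ∀ {v a u b : Fin n}, IsFourCycle G (v, a, u, b) →
      (∀ y ∈ ({v, a, u, b} : Finset (Fin n)), sortKey M x y ≤ sortKey M x v) →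
      Before M x a v ∧ Before M x u v ∧ Before M x b v := by
    intro v a u b h hle
    have key : ∀ y ∈ ({v, a, u, b} : Finset (Fin n)), v ≠ y → Before M x y v := fun y hy hne =>
      before_iff.2 (lt_of_le_of_ne (hle y hy) fun he =>
        hne (Fin.ext (sortKey_injective he).symm))
    obtain ⟨-, -, -, -, h5⟩ := h
    simp only [List.nodup_cons, List.mem_cons, List.not_mem_nil, or_false, not_or] at h5
    exact ⟨key a (by simp) h5.1.1, key u (by simp) h5.1.2.1, key b (by simp) h5.1.2.2⟩
  obtain ⟨v, hv, hle⟩ := Finset.exists_max_image ({a, b, c, d} : Finset (Fin n))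
    (fun y => sortKey M x y) ⟨a, by simp⟩
  have e1 : ({b, c, d, a} : Finset (Fin n)) = {a, b, c, d} := by
    ext; simp only [Finset.mem_insert, Finset.mem_singleton]; tauto
  have e2 : ({c, d, a, b} : Finset (Fin n)) = {a, b, c, d} := by
    ext; simp only [Finset.mem_insert, Finset.mem_singleton]; tauto
  have e3 : ({d, a, b, c} : Finset (Fin n)) = {a, b, c, d} := by
    ext; simp only [Finset.mem_insert, Finset.mem_singleton]; tauto
  have h1 := isFourCycle_rotate h
  have h2 := isFourCycle_rotate h1
  have h3 := isFourCycle_rotate h2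
  simp only [Finset.mem_insert, Finset.mem_singleton] at hv
  rcases hv with rfl | rfl | rfl | rfl
  · exact ⟨_, _, _, _, h, rfl, hmax h hle⟩
  · exact ⟨_, _, _, _, h1, (cycleEdges_rotate _ _ _ _).symm,
      hmax h1 (by rw [e1]; exact hle)⟩
  · exact ⟨_, _, _, _, h2, by rw [cycleEdges_rotate, cycleEdges_rotate],
      hmax h2 (by rw [e2]; exact hle)⟩
  · exact ⟨_, _, _, _, h3, by rw [cycleEdges_rotate, cycleEdges_rotate, cycleEdges_rotate],
      hmax h3 (by rw [e3]; exact hle)⟩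

theorem IsHalfEdges.mem_pairsAt_or (H : IsHalfEdges G M x) {v a u b : Fin n}
    (h : IsFourCycle G (v, a, u, b)) (ha : Before M x a v) (hu : Before M x u v)
    (hb : Before M x b v) :
    ∃ q r : ℕ, x q = a ∧ x r = b ∧ tgt x q = u ∧ tgt x r = u ∧
      ((q, r) ∈ pairsAt M x v ∨ (r, q) ∈ pairsAt M x v) := by
  obtain ⟨h1, h2, h3, h4, h5⟩ := h
  obtain ⟨p, hp, hpv, hpa⟩ := (H.adj_iff _ _).1 h1
  obtain ⟨q, hq, hqa, hqu⟩ := (H.adj_iff _ _).1 h2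
  obtain ⟨r, hr, hrb, hru⟩ := (H.adj_iff _ _).1 h3.symm
  obtain ⟨p', hp', hpv', hpb⟩ := (H.adj_iff _ _).1 h4.symm
  refine ⟨q, r, hqa, hrb, hqu, hru, mem_wedgePairs_or ?_ ?_ ?_ (hqu.trans hru.symm)⟩
  · rw [List.mem_reverse, mem_wedges]
    exact ⟨p, mem_adj.2 ⟨hp, hpv⟩, by rwa [hpa], hq, hqa.trans hpa.symm, by rwa [hqu]⟩
  · rw [List.mem_reverse, mem_wedges]
    exact ⟨p', mem_adj.2 ⟨hp', hpv'⟩, by rwa [hpb], hr, hrb.trans hpb.symm, by rwa [hru]⟩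
  · rintro rfl
    have : a = b := Fin.ext (hqa.symm.trans hrb)
    subst this
    simp at h5

theorem IsHalfEdges.listsFourCycles (H : IsHalfEdges G M x) :
    ListsFourCycles G ((List.range M).flatMap (outAt M x)) ∧
      ((List.range M).flatMap (outAt M x)).length ≤ 4 * (fourCycles G).ncard := by
  classical
  rcases Nat.eq_zero_or_pos n with rfl | hn
  · obtain rfl : M = 0 := by
      by_contra hM
      exact absurd (H.lt 0 (Nat.pos_of_ne_zero hM)) (by omega)
    exact ⟨⟨[], by simp, by simp, by simp, fun S ⟨y, _⟩ => y.1.elim0⟩, by simp⟩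
  have : NeZero n := ⟨hn.ne'⟩
  -- `toTuple` turns a triple from the list into the corresponding tuple of vertices
  obtain ⟨toTuple, hT⟩ : ∃ f : ℕ × ℕ × ℕ → Fin n × Fin n × Fin n × Fin n,
      ∀ y ∈ triples M x, ((f y).1 : ℕ) = y.1 ∧ ((f y).2.1 : ℕ) = x y.2.1 ∧
        ((f y).2.2.1 : ℕ) = tgt x y.2.1 ∧ ((f y).2.2.2 : ℕ) = x y.2.2 := by
    refine ⟨fun y => (Fin.ofNat n y.1, Fin.ofNat n (x y.2.1), Fin.ofNat n (tgt x y.2.1),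
      Fin.ofNat n (x y.2.2)), ?_⟩
    rintro ⟨v, q, r⟩ hy
    obtain ⟨hv, hq, hr, -⟩ := H.of_mem_pairsAt (mem_triples.1 hy)
    simp [Fin.ofNat, Nat.mod_eq_of_lt, hv, H.lt q hq, H.lt r hr, H.tgt_lt hq]
  have hspec : ∀ v q r, (v, q, r) ∈ triples M x → IsFourCycle G (toTuple (v, q, r)) ∧ q < M ∧
      r < M ∧ tgt x r = tgt x q ∧ Before M x (x q) v ∧ Before M x (tgt x q) v ∧
        Before M x (x r) v := by
    intro v q r hy
    obtain ⟨hv, hq, hr, ht, b1, b2, b3, hc⟩ := H.of_mem_pairsAt (mem_triples.1 hy)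
    obtain ⟨t1, t2, t3, t4⟩ := hT _ hy
    refine ⟨?_, hq, hr, ht, b1, b2, b3⟩
    have : toTuple (v, q, r) =
        (⟨v, hv⟩, ⟨x q, H.lt q hq⟩, ⟨tgt x q, H.tgt_lt hq⟩, ⟨x r, H.lt r hr⟩) :=
      Prod.ext (Fin.ext t1) (Prod.ext (Fin.ext t2) (Prod.ext (Fin.ext t3) (Fin.ext t4)))
    rwa [this]
  have hnodup : (((triples M x).map toTuple).map cycleEdges).Nodup := by
    rw [List.map_map]
    refine H.nodup_triples.map_on ?_
    rintro ⟨v, q, r⟩ hy ⟨v', q', r'⟩ hy' hE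
    obtain ⟨hc, hq, hr, ht, b1, b2, b3⟩ := hspec _ _ _ hy
    obtain ⟨hc', hq', hr', ht', b1', b2', b3'⟩ := hspec _ _ _ hy'
    obtain ⟨t1, t2, t3, t4⟩ := hT _ hy
    obtain ⟨t1', t2', t3', t4'⟩ := hT _ hy'
    simp only [Function.comp] at hE
    generalize toTuple (v, q, r) = X at *
    generalize toTuple (v', q', r') = X' at *
    obtain ⟨v₁, a₁, u₁, b₁⟩ := X
    obtain ⟨v₂, a₂, u₂, b₂⟩ := X'
    simp only at t1 t2 t3 t4 t1' t2' t3' t4'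
    obtain ⟨rfl, rfl, hab⟩ := eq_of_cycleEdges_eq
      (R := fun a b : Fin n => Before M x (a : ℕ) (b : ℕ)) (fun a b h => before_asymm h) hc hc'
      (by rwa [t1, t2]) (by rwa [t1, t3]) (by rwa [t1, t4]) (by rwa [t1', t2'])
      (by rwa [t1', t3']) (by rwa [t1', t4']) hE
    obtain rfl : v = v' := t1.symm.trans t1'
    have htt : tgt x q = tgt x q' := t3.symm.trans t3'
    rcases hab with ⟨rfl, rfl⟩ | ⟨rfl, rfl⟩
    · obtain rfl := H.inj q hq q' hq' (t2.symm.trans t2') htt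
      obtain rfl := H.inj r hr r' hr' (t4.symm.trans t4') (ht.trans ht'.symm)
      rfl
    · obtain rfl := H.inj q hq r' hr' (t2.symm.trans t4') (htt.trans ht'.symm)
      obtain rfl := H.inj r hr q' hq' (t4.symm.trans t2') (ht.trans htt)
      exact absurd (mem_triples.1 hy') (swap_notMem_wedgePairs
        (List.nodup_reverse.2 (H.nodup_wedges v)) (mem_triples.1 hy))
  have hcyc : ∀ X ∈ (triples M x).map toTuple, IsFourCycle G X := by
    intro X hX
    obtain ⟨⟨v, q, r⟩, hy, rfl⟩ := List.mem_map.1 hX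
    exact (hspec v q r hy).1
  have hout : (List.range M).flatMap (outAt M x) = ((triples M x).map toTuple).flatMap
      (fun y => [(y.1 : ℕ), (y.2.1 : ℕ), (y.2.2.1 : ℕ), (y.2.2.2 : ℕ)]) := by
    rw [flatMap_outAt, List.flatMap_map]
    refine List.flatMap_congr fun y hy => ?_
    obtain ⟨t1, t2, t3, t4⟩ := hT _ hy
    rw [t1, t2, t3, t4, outWords]
  refine ⟨⟨(triples M x).map toTuple, hout, hcyc, hnodup, ?_⟩, ?_⟩
  · intro S hS
    obtain ⟨v, a, u, b, hc, rfl, ha, hu, hb⟩ := exists_rotation_before (M := M) (x := x) hS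
    obtain ⟨q, r, hq, hr, hqu, hru, h | h⟩ := H.mem_pairsAt_or hc ha hu hb
    · have hy := mem_triples.2 h
      obtain ⟨t1, t2, t3, t4⟩ := hT _ hy
      rw [List.map_map]
      refine List.mem_map.2 ⟨_, hy, ?_⟩
      simp only [Function.comp]
      congr 1
      exact Prod.ext (Fin.ext t1) (Prod.ext (Fin.ext (t2.trans hq))
        (Prod.ext (Fin.ext (t3.trans hqu)) (Fin.ext (t4.trans hr))))
    · have hy := mem_triples.2 h
      obtain ⟨t1, t2, t3, t4⟩ := hT _ hy
      rw [List.map_map]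
      refine List.mem_map.2 ⟨_, hy, ?_⟩
      rw [← cycleEdges_reverse]
      simp only [Function.comp]
      congr 1
      exact Prod.ext (Fin.ext t1) (Prod.ext (Fin.ext (t2.trans hr))
        (Prod.ext (Fin.ext (t3.trans hru)) (Fin.ext (t4.trans hq))))
  · have hlen : (((triples M x).map toTuple).map cycleEdges).length ≤ (fourCycles G).ncard := by
      rw [← List.toFinset_card_of_nodup hnodup, ← Set.ncard_coe_finset]
      refine Set.ncard_le_ncard ?_ (fourCycles_finite G)
      intro S hS
      obtain ⟨X, hX, rfl⟩ := List.mem_map.1 (List.mem_toFinset.1 (Finset.mem_coe.1 hS))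
      exact ⟨X, hcyc X hX, rfl⟩
    rw [hout]
    simp only [List.length_flatMap, List.length_cons, List.length_nil, List.map_const',
      List.sum_replicate, smul_eq_mul, List.length_map] at hlen ⊢
    omega

end Output

/-! ### The running time -/

section Time

variable {n M : ℕ} {G : SimpleGraph (Fin n)} {x : ℕ → ℕ}

theorem sum_map_range (f : ℕ → ℤ) : ((List.range M).map f).sum = ∑ j ∈ Finset.range M, f j := by
  induction M with
  | zero => simp
  | succ k ih => simp [List.range_succ, Finset.sum_range_succ, ih]

theorem sum_map_adj (f : ℕ → ℤ) (v : ℕ) :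
    ((adj M x v).map f).sum = ∑ p ∈ Finset.range M with x p = v, f p := by
  rw [← List.sum_toFinset f (nodup_adj v)]
  congr 1
  ext p
  simp [mem_adj]

theorem sum_costAt_le : ((List.range M).map (costAt M x)).sum ≤
    20 * M + ∑ p ∈ Finset.range M, edgeCost M x (x p) p := by
  have hpos : ∀ p, 0 ≤ edgeCost M x (x p) p := fun p => by
    unfold edgeCost
    split_ifs <;> positivity
  simp only [sum_map_range, costAt, Finset.sum_add_distrib, Finset.sum_const, Finset.card_range,
    sum_map_adj]
  have key : (∑ j ∈ Finset.range M, if (adj M x (x j)).head? = some j then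
        ∑ p ∈ Finset.range M with x p = x j, edgeCost M x (x j) p else 0) =
      ∑ p ∈ Finset.range M, ∑ j ∈ Finset.range M,
        if (adj M x (x j)).head? = some j ∧ x p = x j then edgeCost M x (x p) p else 0 := by
    rw [Finset.sum_comm]
    refine Finset.sum_congr rfl fun j _ => ?_
    by_cases h : (adj M x (x j)).head? = some j
    · simp only [h, if_true, true_and, Finset.sum_filter]
      refine Finset.sum_congr rfl fun p _ => ?_
      split_ifs with hp
      · rw [hp]
      · rfl
    · simp [h]
  rw [key]
  have hle : ∀ p ∈ Finset.range M, (∑ j ∈ Finset.range M,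
      if (adj M x (x j)).head? = some j ∧ x p = x j then edgeCost M x (x p) p else 0) ≤
      edgeCost M x (x p) p := by
    intro p _
    rw [← Finset.sum_filter, Finset.sum_const, nsmul_eq_mul]
    -- an adjacency list has only one first half-edge
    have hc : ((Finset.range M).filter
        (fun j => (adj M x (x j)).head? = some j ∧ x p = x j)).card ≤ 1 := by
      refine Finset.card_le_one.2 fun j hj j' hj' => ?_
      obtain ⟨-, h1, h2⟩ := Finset.mem_filter.1 hj
      obtain ⟨-, h3, h4⟩ := Finset.mem_filter.1 hj'
      rw [← h2] at h1
      rw [← h4] at h3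
      exact Option.some.inj (h1.symm.trans h3)
    have hc' : ((((Finset.range M).filter
        (fun j => (adj M x (x j)).head? = some j ∧ x p = x j)).card : ℕ) : ℤ) ≤ 1 := by
      exact_mod_cast hc
    nlinarith [hpos p]
  have := Finset.sum_le_sum hle
  simp only [nsmul_eq_mul]
  linarith

variable [DecidableRel G.Adj]

theorem IsHalfEdges.length_adj (H : IsHalfEdges G M x) (a : Fin n) :
    (adj M x a).length = G.degree a := by
  rw [← List.toFinset_card_of_nodup (nodup_adj _), ← SimpleGraph.card_neighborFinset_eq_degree]
  refine Finset.card_bij (fun j hj => ⟨tgt x j, H.tgt_lt (mem_adj.1 (List.mem_toFinset.1 hj)).1⟩)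
    ?_ ?_ ?_
  · intro j hj
    obtain ⟨hj, hja⟩ := mem_adj.1 (List.mem_toFinset.1 hj)
    exact (G.mem_neighborFinset _ _).2 ((H.adj_iff _ _).2 ⟨j, hj, hja, rfl⟩)
  · intro j hj j' hj' h
    obtain ⟨hj, hja⟩ := mem_adj.1 (List.mem_toFinset.1 hj)
    obtain ⟨hj', hja'⟩ := mem_adj.1 (List.mem_toFinset.1 hj')
    exact H.inj j hj j' hj' (hja.trans hja'.symm) (Fin.mk.inj h)
  · intro b hb
    obtain ⟨j, hj, hja, hjb⟩ := (H.adj_iff _ _).1 ((G.mem_neighborFinset _ _).1 hb)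
    exact ⟨j, List.mem_toFinset.2 (mem_adj.2 ⟨hj, hja⟩), Fin.ext hjb⟩

theorem IsHalfEdges.sum_edgeCost_le (H : IsHalfEdges G M x) :
    ∑ p ∈ Finset.range M, edgeCost M x (x p) p ≤ 19 * M + 50 *
      ((∑ p : Fin n × Fin n with G.Adj p.1 p.2 ∧ G.degree p.1 ≤ G.degree p.2, G.degree p.1 : ℕ) :
        ℤ) := by
  simp only [edgeCost, Finset.sum_add_distrib, Finset.sum_const, Finset.card_range, nsmul_eq_mul]
  rw [mul_comm (M : ℤ)]
  gcongr
  have hinj : ((Finset.range M).filter (fun p => Before M x (tgt x p) (x p))).sum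
      (fun p => (adj M x (tgt x p)).length) ≤
      ∑ p : Fin n × Fin n with G.Adj p.1 p.2 ∧ G.degree p.1 ≤ G.degree p.2, G.degree p.1 := by
    have hlt : ∀ p ∈ (Finset.range M).filter (fun p => Before M x (tgt x p) (x p)), p < M :=
      fun p hp => Finset.mem_range.1 (Finset.mem_filter.1 hp).1
    rw [← Finset.sum_attach]
    let f : {p // p ∈ (Finset.range M).filter (fun p => Before M x (tgt x p) (x p))} →
        Fin n × Fin n := fun p =>
      (⟨tgt x p, H.tgt_lt (hlt p p.2)⟩, ⟨x p, H.lt p (hlt p p.2)⟩)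
    have hf : Function.Injective f := by
      intro p p' h
      obtain ⟨h1, h2⟩ := Prod.mk.inj h
      exact Subtype.ext (H.inj p (hlt p p.2) p' (hlt p' p'.2) (Fin.mk.inj h2) (Fin.mk.inj h1))
    calc _ = ∑ p ∈ Finset.attach _, G.degree (f p).1 :=
          Finset.sum_congr rfl fun p _ => H.length_adj (f p).1
      _ = ∑ y ∈ (Finset.attach _).map ⟨f, hf⟩, G.degree y.1 := by
          rw [Finset.sum_map]; rfl
      _ ≤ _ := by
          refine Finset.sum_le_sum_of_subset fun y hy => ?_
          obtain ⟨p, -, rfl⟩ := Finset.mem_map.1 hy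
          have hB := (Finset.mem_filter.1 p.2).2
          refine Finset.mem_filter.2 ⟨Finset.mem_univ _, ?_, ?_⟩
          · exact ((H.adj_iff _ _).2 ⟨p, hlt p p.2, rfl, rfl⟩ : G.Adj (f p).2 (f p).1).symm
          · have h1 := H.length_adj (f p).1
            have h2 := H.length_adj (f p).2
            change (adj M x (tgt x p)).length = _ at h1
            change (adj M x (x p)).length = _ at h2
            change G.degree (f p).1 ≤ G.degree (f p).2
            rw [← h1, ← h2]
            rcases hB with h | h
            · exact h.le
            · exact h.1.le
  rw [Finset.sum_filter] at hinj
  calc (∑ p ∈ Finset.range M, ((if Before M x (tgt x p) (x p) then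
        50 * (adj M x (tgt x p)).length else 0 : ℕ) : ℤ))
      = 50 * ((∑ p ∈ Finset.range M, if Before M x (tgt x p) (x p) then
        (adj M x (tgt x p)).length else 0 : ℕ) : ℤ) := by
        push_cast
        rw [Finset.mul_sum]
        refine Finset.sum_congr rfl fun p _ => ?_
        split_ifs <;> simp
    _ ≤ _ := by
        have : ((∑ p ∈ Finset.range M, if Before M x (tgt x p) (x p) then
          (adj M x (tgt x p)).length else 0 : ℕ) : ℤ) ≤ _ := Int.ofNat_le.2 hinj
        exact mul_le_mul_of_nonneg_left this (by norm_num)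

end Time

/-! ### The input -/

section Input

variable {n : ℕ}

theorem getD_flatMap_pair (L : List (Fin n × Fin n)) (i : ℕ) (h : i < L.length) :
    (L.flatMap fun e => [(e.1 : ℕ), (e.2 : ℕ)]).getD (2 * i) 0 = L[i].1 ∧
      (L.flatMap fun e => [(e.1 : ℕ), (e.2 : ℕ)]).getD (2 * i + 1) 0 = L[i].2 := by
  induction L generalizing i with
  | nil => simp at h
  | cons e L ih =>
    cases i with
    | zero => simp
    | succ i =>
      have := ih i (by simpa using h)
      simpa [Nat.mul_succ] using this

theorem two_mul_xor_one (i : ℕ) : (2 * i) ^^^ 1 = 2 * i + 1 := by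
  rw [Nat.xor_one_of_even (by simp)]

theorem two_mul_add_one_xor_one (i : ℕ) : (2 * i + 1) ^^^ 1 = 2 * i := by
  rw [Nat.xor_one_of_odd (by simp)]; simp

theorem isHalfEdges_initState {G : SimpleGraph (Fin n)} {L : List (Fin n × Fin n)}
    (hL : IsEdgeList G L) : IsHalfEdges G (2 * L.length) (initState n L).mem := by
  set x := (initState n L).mem with hx
  have h0 : ∀ i (h : i < L.length), x (2 * i) = L[i].1 := fun i h => (getD_flatMap_pair L i h).1
  have h1 : ∀ i (h : i < L.length), x (2 * i + 1) = L[i].2 :=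
    fun i h => (getD_flatMap_pair L i h).2
  have t0 : ∀ i (h : i < L.length), tgt x (2 * i) = L[i].2 := fun i h => by
    rw [tgt, two_mul_xor_one, h1 i h]
  have t1 : ∀ i (h : i < L.length), tgt x (2 * i + 1) = L[i].1 := fun i h => by
    rw [tgt, two_mul_add_one_xor_one, h0 i h]
  have hcases : ∀ j < 2 * L.length, ∃ i, i < L.length ∧ (j = 2 * i ∨ j = 2 * i + 1) :=
    fun j hj => ⟨j / 2, by omega, by omega⟩
  have hadj : ∀ i (h : i < L.length), G.Adj L[i].1 L[i].2 := fun i h =>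
    (hL.2 s(L[i].1, L[i].2)).1 (List.mem_map.2 ⟨L[i], List.getElem_mem h, rfl⟩)
  have hinj : ∀ i (h : i < L.length) k (h' : k < L.length),
      s(L[i].1, L[i].2) = s(L[k].1, L[k].2) → i = k := by
    intro i h k h' he
    refine (hL.1.getElem_inj_iff (hi := by simpa using h) (hj := by simpa using h')).1 ?_
    simpa using he
  refine ⟨?_, ?_, ?_, ?_⟩
  · intro j hj
    obtain ⟨i, hi, rfl | rfl⟩ := hcases j hj
    · rw [h0 i hi]; exact L[i].1.2
    · rw [h1 i hi]; exact L[i].2.2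
  · intro j hj
    obtain ⟨i, hi, rfl | rfl⟩ := hcases j hj
    · rw [two_mul_xor_one]; omega
    · rw [two_mul_add_one_xor_one]; omega
  · intro p hp q hq hs ht
    obtain ⟨i, hi, hpi⟩ := hcases p hp
    obtain ⟨k, hk, hqk⟩ := hcases q hq
    have hne := (hadj i hi).ne
    have hik : i = k := by
      refine hinj i hi k hk (Sym2.eq_iff.2 ?_)
      rcases hpi with rfl | rfl <;> rcases hqk with rfl | rfl <;>
        simp only [h0, h1, t0, t1, hi, hk] at hs ht
      · exact Or.inl ⟨Fin.ext hs, Fin.ext ht⟩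
      · exact Or.inr ⟨Fin.ext hs, Fin.ext ht⟩
      · exact Or.inr ⟨Fin.ext ht, Fin.ext hs⟩
      · exact Or.inl ⟨Fin.ext ht, Fin.ext hs⟩
    subst hik
    rcases hpi with rfl | rfl <;> rcases hqk with rfl | rfl
    · rfl
    · rw [h0 i hi, h1 i hi] at hs
      exact absurd (Fin.ext hs) hne
    · rw [h0 i hi, h1 i hi] at hs
      exact absurd (Fin.ext hs).symm hne
    · rfl
  · intro a b
    constructor
    · intro h
      obtain ⟨e, he, hab⟩ := List.mem_map.1 ((hL.2 s(a, b)).2 h)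
      obtain ⟨i, hi, rfl⟩ := List.getElem_of_mem he
      rcases Sym2.eq_iff.1 hab with ⟨rfl, rfl⟩ | ⟨rfl, rfl⟩
      · exact ⟨2 * i, by omega, h0 i hi, t0 i hi⟩
      · exact ⟨2 * i + 1, by omega, h1 i hi, t1 i hi⟩
    · rintro ⟨j, hj, ha, hb⟩
      obtain ⟨i, hi, rfl | rfl⟩ := hcases j hj
      · rw [h0 i hi] at ha
        rw [t0 i hi] at hb
        rw [← Fin.ext ha, ← Fin.ext hb]
        exact hadj i hi
      · rw [h1 i hi] at ha
        rw [t1 i hi] at hb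
        rw [← Fin.ext ha, ← Fin.ext hb]
        exact (hadj i hi).symm

theorem length_eq_of_isEdgeList {G : SimpleGraph (Fin n)} {L : List (Fin n × Fin n)}
    (hL : IsEdgeList G L) : L.length = G.edgeSet.ncard := by
  classical
  have h : G.edgeSet = ((L.map fun e => s(e.1, e.2)).toFinset : Set (Sym2 (Fin n))) := by
    ext e
    rw [Finset.mem_coe, List.mem_toFinset, hL.2 e]
  rw [h, Set.ncard_coe_finset, List.toFinset_card_of_nodup hL.1, List.length_map]

theorem initState_mem (L : List (Fin n × Fin n)) : (initState n L).mem =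
    layout (2 * L.length) n (initState n L).mem 0 0 0 0 0 0 := by
  funext i
  by_cases hi : i < 2 * L.length
  · rw [layout_x hi]
  · have hlen : (L.flatMap fun e => [(e.1 : ℕ), (e.2 : ℕ)]).length = 2 * L.length := by
      simp [List.length_flatMap, mul_comm]
    have hzero : (initState n L).mem i = 0 := by
      change (L.flatMap fun e => [(e.1 : ℕ), (e.2 : ℕ)]).getD i 0 = 0
      exact List.getD_eq_default _ _ (by omega)
    rw [hzero]
    simp only [layout, if_neg hi]
    split_ifs <;> rfl

end Input

end WordRAM

/-! ### The bound in terms of edges and 4-cycles -/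

/-- A bound in terms of the binary logarithm is one in terms of the natural logarithm. -/
theorem natLog_two_mul_le (m : ℕ) : (Nat.log 2 (2 * m) + 1 : ℝ) ≤ 5 * Real.log (m + 2) := by
  have hlog2 : (0.69 : ℝ) < Real.log 2 := lt_trans (by norm_num) Real.log_two_gt_d9
  have hmono : Real.log 2 ≤ Real.log (m + 2) :=
    Real.log_le_log (by norm_num) (by linarith [(Nat.cast_nonneg m : (0 : ℝ) ≤ m)])
  rcases Nat.eq_zero_or_pos m with rfl | hm
  · norm_num
    linarith
  have h1 : (2 : ℝ) ^ Nat.log 2 (2 * m) ≤ 2 * m := by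
    exact_mod_cast Nat.pow_log_le_self 2 (show 2 * m ≠ 0 by omega)
  have hm' : (0 : ℝ) < m := by exact_mod_cast hm
  have h2 := Real.log_le_log (by positivity) h1
  rw [Real.log_pow, Real.log_mul (by norm_num) hm'.ne'] at h2
  have h3 : Real.log m ≤ Real.log (m + 2) := Real.log_le_log hm' (by linarith)
  nlinarith [(Nat.cast_nonneg (Nat.log 2 (2 * m)) : (0 : ℝ) ≤ _)]

open WordRAM in
theorem mainTheorem9 :
    ∃ (P : WordRAM.Program) (K c : ℕ) (C : ℝ),
      ∀ (n w : ℕ) (G : SimpleGraph (Fin n)) (L : List (Fin n × Fin n)),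
        IsEdgeList G L →
        K * (n + G.edgeSet.ncard + 1) ≤ 2 ^ w →
        ∃ (s : WordRAM.State) (T : ℕ),
          WordRAM.Runs w P (WordRAM.initState n L) s T ∧
          ListsFourCycles G s.out ∧
          (T : ℝ) ≤ C * ((G.edgeSet.ncard : ℝ) ^ (4 / 3 : ℝ) + ((fourCycles G).ncard : ℝ) + 1) *
            Real.log ((G.edgeSet.ncard : ℝ) + 2) ^ c := by
  classical
  -- the arrays take `6 m + 4 n` cells, whose addresses must be words
  refine ⟨listFourCycles, 8, 1, 5000000, fun n w G L hL hK => ?_⟩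
  have hlen := length_eq_of_isEdgeList hL
  have H := isHalfEdges_initState hL
  obtain ⟨s, T, hrun, hout, hT⟩ := reaches_listFourCycles (w := w) (n := n) (M := 2 * L.length)
    (x := (initState n L).mem) (s := initState n L) (by omega) H.lt H.xor_lt H.inj rfl rfl
    (fun i hi => by simp [initState, show i ≠ 0 by omega, show i ≠ 1 by omega])
    (initState_mem L) rfl
  obtain ⟨hlists, hlength⟩ := H.listsFourCycles
  rw [← hout] at hlists hlength
  refine ⟨s, T, hrun, hlists, ?_⟩
  have hcost := (sum_costAt_le (M := 2 * L.length) (x := (initState n L).mem)).trans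
    (add_le_add_right H.sum_edgeCost_le _)
  have hsum := sum_min_degree_le G
  have hcard : G.edgeFinset.card = L.length := by
    rw [hlen, ← SimpleGraph.coe_edgeFinset, Set.ncard_coe_finset]
  rw [hcard] at hsum
  rw [← hlen]
  set m := L.length
  set t := (fourCycles G).ncard
  generalize (∑ p : Fin n × Fin n with G.Adj p.1 p.2 ∧ G.degree p.1 ≤ G.degree p.2,
    G.degree p.1 : ℕ) = W at hcost hsum
  have hTZ : (T : ℤ) ≤ 12 + 13 * (2 * m) + (20 * (2 * m) + (19 * (2 * m) + 50 * W)) + 12 * t := by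
    have h0 : (initState n L).out.length = 0 := rfl
    rw [h0] at hT
    push_cast at hT hcost
    have : (s.out.length : ℤ) ≤ 4 * t := by exact_mod_cast hlength
    linarith
  have hTR : (T : ℝ) ≤ 12 + 104 * m + 50 * W + 12 * t := by
    have : (T : ℤ) ≤ 12 + 104 * m + 50 * W + 12 * t := by linarith
    exact_mod_cast this
  have hpow : (m : ℝ) ≤ (m : ℝ) ^ (4 / 3 : ℝ) := by
    rcases Nat.eq_zero_or_pos m with h0 | h0
    · rw [h0]; norm_num
    · exact Real.self_le_rpow_of_one_le (by exact_mod_cast h0) (by norm_num)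
  have hlog := natLog_two_mul_le m
  have hlog1 : 1 ≤ 5 * Real.log ((m : ℝ) + 2) :=
    le_trans (by linarith [(Nat.cast_nonneg (Nat.log 2 (2 * m)) : (0 : ℝ) ≤ _)]) hlog
  rw [pow_one]
  have ht0 : (0 : ℝ) ≤ t := Nat.cast_nonneg _
  have hm0 : (0 : ℝ) ≤ (m : ℝ) ^ (4 / 3 : ℝ) := by positivity
  generalize (m : ℝ) ^ (4 / 3 : ℝ) = A at *
  generalize Real.log ((m : ℝ) + 2) = ℓ at *
  have hW : (W : ℝ) ≤ 16384 * (5 * ℓ) * (A + t) := hsum.trans (by gcongr)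
  have hA : 0 ≤ A + t + 1 := by linarith
  have h1 : 16384 * (5 * ℓ) * (A + t) ≤ 16384 * (5 * ℓ) * (A + t + 1) :=
    mul_le_mul_of_nonneg_left (by linarith) (by linarith)
  have h2 : 104 * (A + t + 1) * 1 ≤ 104 * (A + t + 1) * (5 * ℓ) :=
    mul_le_mul_of_nonneg_left hlog1 (by linarith)
  calc (T : ℝ) ≤ 104 * (A + t + 1) * 1 + 50 * (16384 * (5 * ℓ) * (A + t)) := by linarith
    _ ≤ 104 * (A + t + 1) * (5 * ℓ) + 50 * (16384 * (5 * ℓ) * (A + t + 1)) := by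
        linarith
    _ = 4096520 * ((A + t + 1) * ℓ) := by ring
    _ ≤ 5000000 * ((A + t + 1) * ℓ) := by
        have : 0 ≤ (A + t + 1) * ℓ := mul_nonneg hA (by linarith)
        linarith
    _ = _ := by ring
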